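/- **Asymmetric hub model.** Let $1\le n_L\le n$. Nodes are $1,\dots,n$; nodes $1,\dots,n_L$ are the potential hubs. The parameters are $\rho=(\rho_1,\dots,\rho_{n_L})$ with $\rho_i\ge 0$, $\sum_i\rho_i=1$, and $A\in[0,1]^{n_L\times n}$ with $A_{ii}=1$ for $i\le n_L$. One observes the groups $G^{(1)},\dots,G^{(T)}\in\{0,1\}^n$, where the pairs $(z_*^{(t)},G^{(t)})$, $t=1,\dots,T$, are independent, the latent hub satisfies $\mathbb P(z_*^{(t)}=i)=\rho_i$, and, given $z_*^{(t)}=i$, the coordinates $G^{(t)}_j$ are independent with $\mathbb P(G^{(t)}_j=1\mid z_*^{(t)}=i)=A_{ij}$. For a label assignment $z\in\{1,\dots,n_L\}^T$ put $t_i=\sum_t 1(z^{(t)}=i)$, $$\hat A^z_{ij}=\frac{\sum_t G^{(t)}_j\,1(z^{(t)}=i)}{t_i},\qquad L_G(z)=\sum_{t=1}^T\sum_{j=1}^n \Big(G_j^{(t)}\log \hat A^z_{z^{(t)},j}+(1-G_j^{(t)})\log\big(1-\hat A^z_{z^{(t)},j}\big)\Big)$$ (with $0\log 0=0$). Call $z$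 feasible if $G^{(t)}_{z^{(t)}}=1$ for all $t$, i.e. the assigned hub belongs to the group; since $A_{ii}=1$, all other assignments have likelihood zero. Let $\hat z$ be any maximizer of $L_G$ over the feasible assignments (one exists almost surely). **Theorem.** Consider a sequence of such models in which $n$, $T$, $n_L$, $\rho$, $A$ and $d,v>0$ may vary along the sequence, with $n\to\infty$ and $T\to\infty$. Assume that * there are constants $0<c_{\min *}\le c_{\max *}$ with $c_{\min *}/n_L\le\rho_i\le c_{\max *}/n_L$ for all $i\le n_L$; * for each $i\le n_L$ there is a set $V_i\subset\{1,\dots,n\}$ with $|V_i|\ge vn/n_L$ and $A_{ij}-A_{i'j}\ge d$ for all $j\in V_i$ and all $i'\neq i$, $i'\le n_L$. (a) (Growing number of hubs.) If $n_L\to\infty$, there is a constant $c_0>0$ with $A_{ii'}\le c_0/n_L$ for all $i\ne i'$, $i,i'\le n_L$, and $$\frac{n_L^2\log n_L}{T}\to0,\qquad \frac{n_L^3\log T}{d^2vT}\to0,\qquad \frac{n_L^4\log n_L}{d^4v^2n}\to0,\qquad \frac{n_L\log n}{T}\to0,$$ then $$\max_{1\le i\le n_L,\,1\le j\le n}\big|\hat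 A^{\hat z}_{ij}-A_{ij}\big|=o_p(1).$$ (b) (Fixed number of hubs.) If $n_L$ is fixed, there is a constant $c<1$ with $A_{ii'}\le c$ for all $i\neq i'$, $i,i'\le n_L$, and $$\frac{\log T}{d^2vT}\to0,\qquad d^4v^2n\to\infty,\qquad \frac{\log n}{T}\to0,$$ then likewise $$\max_{1\le i\le n_L,\,1\le j\le n}\big|\hat A^{\hat z}_{ij}-A_{ij}\big|=o_p(1).$$ -/

import Mathlib

open MeasureTheory ProbabilityTheory Filter Topology

/-- Parameters of the asymmetric hub model with `n` nodes of which the first `nL` are the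
potential hubs: `ρ i` is the probability that a group is formed by hub `i`, and `A i j` is the
probability that node `j` appears in a group formed by hub `i`. A hub always appears in its own
groups, so `A i i = 1`; hub `i` is node `Fin.castLE le i`. -/
structure HubParams (nL n : ℕ) where
  le : nL ≤ n
  ρ : Fin nL → ℝ
  A : Fin nL → Fin n → ℝ
  ρ_nonneg : ∀ i, 0 ≤ ρ i
  ρ_sum : ∑ i, ρ i = 1
  A_nonneg : ∀ i j, 0 ≤ A i j
  A_le_one : ∀ i j, A i j ≤ 1
  A_self : ∀ i, A i (Fin.castLE le i) = 1

/-- `z t` (hub labels) and `G t` (membership vectors), `t = 1, …, T`, are a sample of size `T`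
from the hub model: the pairs `(z t, G t)` are independent over `t`, the hub `z t` is `i` with
probability `ρ i`, and given `z t = i` the nodes appear independently, node `j` with
probability `A i j`. -/
structure IsHubSample {nL n T : ℕ} (θ : HubParams nL n) {Ω : Type*} [MeasurableSpace Ω]
    (μ : Measure Ω) (z : Fin T → Ω → Fin nL) (G : Fin T → Ω → Fin n → Bool) : Prop where
  measurable_z : ∀ t, Measurable (z t)
  measurable_G : ∀ t, Measurable (G t)
  indep : iIndepFun (fun t ω => (z t ω, G t ω)) μ
  law : ∀ t i (g : Fin n → Bool),
    μ.real {ω | z t ω = i ∧ G t ω = g}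
      = θ.ρ i * ∏ j, (if g j = true then θ.A i j else 1 - θ.A i j)

/-- The number `t_i` of groups to which the assignment `z` gives the label `i`. -/
def hubCount {nL T : ℕ} (z : Fin T → Fin nL) (i : Fin nL) : ℕ :=
  (Finset.univ.filter fun t => z t = i).card

/-- The estimator `Â^z`: the frequency of node `j` among the groups labelled `i` by `z`
(it is only meaningful when there is such a group). -/
noncomputable def estA {nL n T : ℕ} (G : Fin T → Fin n → Bool) (z : Fin T → Fin nL)
    (i : Fin nL) (j : Fin n) : ℝ :=
  (∑ t, if G t j = true ∧ z t = i then (1 : ℝ) else 0) / (hubCount z i : ℝ)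

/-- The log-likelihood `L_G(A | z)` of the groups `G` given the labels `z`. -/
noncomputable def condLogLik {nL n T : ℕ} (G : Fin T → Fin n → Bool) (A : Fin nL → Fin n → ℝ)
    (z : Fin T → Fin nL) : ℝ :=
  ∑ t, ∑ j, if G t j = true then Real.log (A (z t) j) else Real.log (1 - A (z t) j)

/-- The profile log-likelihood `L_G(z)`, with `Â^z` plugged in. The logarithms that occur in it
are never taken at `0`. -/
noncomputable def profileLogLik {nL n T : ℕ} (G : Fin T → Fin n → Bool)
    (z : Fin T → Fin nL) : ℝ :=
  condLogLik G (estA G z) z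

/-- A label assignment is feasible if every group contains the hub assigned to it. As
`A i i = 1`, any other assignment has likelihood zero. -/
def Feasible {nL n T : ℕ} (h : nL ≤ n) (G : Fin T → Fin n → Bool) (z : Fin T → Fin nL) : Prop :=
  ∀ t, G t (Fin.castLE h (z t)) = true

/-- `z` is a maximum profile likelihood estimate of the hub labels. -/
def IsProfileMLE {nL n T : ℕ} (h : nL ≤ n) (G : Fin T → Fin n → Bool)
    (z : Fin T → Fin nL) : Prop :=
  Feasible h G z ∧ ∀ z' : Fin T → Fin nL, Feasible h G z' → profileLogLik G z' ≤ profileLogLik G z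

/-- For every hub `i` there is a set `V i` of at least `v n / nL` nodes which join the groups of
hub `i` with a probability larger by at least `d` than those of any other hub. -/
def HubsSeparated {nL n : ℕ} (θ : HubParams nL n) (d v : ℝ) : Prop :=
  ∃ V : Fin nL → Finset (Fin n), ∀ i,
    v * (n : ℝ) / (nL : ℝ) ≤ ((V i).card : ℝ) ∧
      ∀ j ∈ V i, ∀ i', i' ≠ i → d ≤ θ.A i j - θ.A i' j

/-- `max_{i,j} |Â^z_{ij} - A_{ij}|`. -/
noncomputable def maxError {nL n T : ℕ} (θ : HubParams nL n) (G : Fin T → Fin n → Bool)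
    (z : Fin T → Fin nL) : ℝ :=
  ⨆ p : Fin nL × Fin n, |estA G z p.1 p.2 - θ.A p.1 p.2|

/-!
The Hellinger affinity of Bernoulli variables with parameters `p` and `q` is at most
`exp (-(p - q) ^ 2 / 4)`, so Markov's inequality for the square root of the likelihood ratio shows
that a fixed matrix `B` with fixed labels is as likely as the true parameters with probability at
most `exp (-E / 4)`, where `E` is the sum of the squared differences of the two mean vectors of the
sample. The pair of estimated labels and matrix takes at most `nL ^ T * (T + 1) ^ (nL * n)` values,
and the union bound over them gives control of `E` for the maximizer.

Feasibility pins the labels of the groups that contain a single hub. Hence a fixed proportion of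
every estimated class is labelled correctly, and separation of the hubs turns the bound on `E` into
`o(T / nL)` mislabelled groups. The labels being that accurate, Bernstein's inequality and a union
bound over the entries finish the proof.
-/

/-- The probability of `b` under the Bernoulli law with success probability `p`. -/
def bernWeight (p : ℝ) (b : Bool) : ℝ := if b = true then p else 1 - p

lemma bernWeight_nonneg {p : ℝ} (hp : p ∈ Set.Icc 0 1) (b : Bool) : 0 ≤ bernWeight p b := by
  cases b
  · simpa [bernWeight] using hp.2
  · simpa [bernWeight] using hp.1

lemma sum_bernWeight_mul (p : ℝ) (f : Bool → ℝ) :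
    ∑ b, bernWeight p b * f b = p * f true + (1 - p) * f false := by
  simp [bernWeight]

section Product

variable {ι : Type*} [Fintype ι]

lemma prod_bernWeight_nonneg {a : ι → ℝ} (ha : ∀ j, a j ∈ Set.Icc 0 1) (g : ι → Bool) :
    0 ≤ ∏ j, bernWeight (a j) (g j) :=
  Finset.prod_nonneg fun j _ => bernWeight_nonneg (ha j) (g j)

variable [DecidableEq ι]

lemma sum_prod_bernWeight_mul_prod (a : ι → ℝ) (f : ι → Bool → ℝ) :
    ∑ g : ι → Bool, (∏ j, bernWeight (a j) (g j)) * ∏ j, f j (g j)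
      = ∏ j, ∑ b, bernWeight (a j) b * f j b := by
  simp only [← Finset.prod_mul_distrib]
  exact (Fintype.prod_sum fun j b => bernWeight (a j) b * f j b).symm

lemma sum_prod_bernWeight_mul_apply (a : ι → ℝ) (j : ι) (f : Bool → ℝ) :
    ∑ g : ι → Bool, (∏ k, bernWeight (a k) (g k)) * f (g j)
      = ∑ b, bernWeight (a j) b * f b := by
  have h := sum_prod_bernWeight_mul_prod a fun k b => if k = j then f b else 1
  simp only [Finset.prod_ite_eq', Finset.mem_univ, if_true] at h
  rw [h, Finset.prod_eq_single j (fun k _ hk => by simp [hk, bernWeight]) (by simp)]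
  simp

lemma sum_prod_bernWeight (a : ι → ℝ) : ∑ g : ι → Bool, ∏ j, bernWeight (a j) (g j) = 1 := by
  simpa [bernWeight] using sum_prod_bernWeight_mul_prod a fun _ _ => 1

lemma sum_prod_bernWeight_mul_ite_forall_eq_false (a : ι → ℝ) (s : Finset ι) :
    ∑ g : ι → Bool, (∏ j, bernWeight (a j) (g j)) * (if ∀ j ∈ s, g j = false then 1 else 0)
      = ∏ j ∈ s, (1 - a j) := by
  have h := sum_prod_bernWeight_mul_prod a fun j b => if j ∈ s → b = false then 1 else 0
  simp only [Finset.prod_ite_zero, Finset.mem_univ, true_imp_iff, Finset.prod_const_one,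
    sum_bernWeight_mul] at h
  rw [h, ← Finset.prod_subset s.subset_univ fun j _ hj => by simp [hj]]
  exact Finset.prod_congr rfl fun j hj => by simp [hj]

end Product

section Affinity

lemma sqrt_mul_sqrt_le {x y : ℝ} (hx : x ∈ Set.Icc 0 1) (hy : y ∈ Set.Icc 0 1) :
    √x * √y ≤ (x + y) / 2 - (x - y) ^ 2 / 8 := by
  have hx' := Real.sq_sqrt hx.1
  have hy' := Real.sq_sqrt hy.1
  have hsum : √x + √y ≤ 2 := by
    linarith [Real.sqrt_le_one.2 hx.2, Real.sqrt_le_one.2 hy.2]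
  have hsq : (√x + √y) ^ 2 ≤ 4 := by
    nlinarith [Real.sqrt_nonneg x, Real.sqrt_nonneg y]
  have hfactor : (x - y) ^ 2 = (√x + √y) ^ 2 * (√x - √y) ^ 2 := by
    rw [← hx', ← hy']; simp only [Real.sqrt_sq (Real.sqrt_nonneg _)]; ring
  nlinarith [mul_le_mul_of_nonneg_right hsq (sq_nonneg (√x - √y))]

lemma mul_sqrt_div {x : ℝ} (hx : 0 ≤ x) (y : ℝ) : x * √(y / x) = √x * √y := by
  rw [Real.sqrt_div' y hx, mul_div_left_comm, Real.div_sqrt, mul_comm]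

lemma sum_bernWeight_mul_sqrt_div_le {p q : ℝ} (hp : p ∈ Set.Icc 0 1) (hq : q ∈ Set.Icc 0 1) :
    ∑ b, bernWeight p b * √(bernWeight q b / bernWeight p b) ≤ Real.exp (-(p - q) ^ 2 / 4) := by
  have htrue := sqrt_mul_sqrt_le hp hq
  have hfalse := sqrt_mul_sqrt_le (Set.Icc.mem_iff_one_sub_mem.1 hp)
    (Set.Icc.mem_iff_one_sub_mem.1 hq)
  simp only [mul_sqrt_div (bernWeight_nonneg hp _), Fintype.sum_bool]
  simp only [bernWeight, if_true, Bool.false_eq_true, if_false]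
  linarith [Real.add_one_le_exp (-(p - q) ^ 2 / 4)]

lemma sum_prod_bernWeight_mul_prod_sqrt_div_le {ι : Type*} [Fintype ι] [DecidableEq ι]
    {p q : ι → ℝ} (hp : ∀ j, p j ∈ Set.Icc 0 1) (hq : ∀ j, q j ∈ Set.Icc 0 1) :
    ∑ g : ι → Bool, (∏ j, bernWeight (p j) (g j))
        * ∏ j, √(bernWeight (q j) (g j) / bernWeight (p j) (g j))
      ≤ Real.exp (-(∑ j, (p j - q j) ^ 2) / 4) := by
  rw [sum_prod_bernWeight_mul_prod p fun j b => √(bernWeight (q j) b / bernWeight (p j) b),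
    neg_div, Finset.sum_div, ← Finset.sum_neg_distrib, Real.exp_sum]
  refine Finset.prod_le_prod (fun j _ => Finset.sum_nonneg fun b _ =>
    mul_nonneg (bernWeight_nonneg (hp j) b) (Real.sqrt_nonneg _)) fun j _ => ?_
  simpa only [neg_div] using sum_bernWeight_mul_sqrt_div_le (hp j) (hq j)

end Affinity

section MaximumLikelihood

lemma pow_le_div_pow_mul_exp {p N : ℝ} (hp : 0 ≤ p) (hN : 0 < N) (k : ℕ) :
    p ^ k ≤ (k / N) ^ k * Real.exp (N * p - k) := by
  rcases k.eq_zero_or_pos with rfl | hk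
  · simpa using mul_nonneg hN.le hp
  have : (0 : ℝ) < k := Nat.cast_pos.2 hk
  calc p ^ k = (k / N * (N * p / k)) ^ k := by congr 1; field_simp
    _ ≤ (k / N * Real.exp (N * p / k - 1)) ^ k := by
      gcongr
      linarith [Real.add_one_le_exp (N * p / k - 1)]
    _ = (k / N) ^ k * Real.exp (N * p - k) := by
      rw [mul_pow, ← Real.exp_nat_mul]
      congr 2
      field_simp

variable {α : Type*} (s : Finset α) (b : α → Bool)

lemma prod_bernWeight_eq_pow_mul_pow (p : ℝ) :
    ∏ t ∈ s, bernWeight p (b t)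
      = p ^ (s.filter (b · = true)).card * (1 - p) ^ (s.filter (¬ b · = true)).card := by
  simp only [bernWeight, Finset.prod_ite, Finset.prod_const]

lemma card_filter_div_card_mem_Icc (P : α → Prop) [DecidablePred P] :
    ((s.filter P).card / s.card : ℝ) ∈ Set.Icc 0 1 :=
  ⟨by positivity, div_le_one_of_le₀ (mod_cast Finset.card_filter_le s P) (Nat.cast_nonneg _)⟩

lemma one_sub_card_filter_div_card (hs : s.Nonempty) (P : α → Prop) [DecidablePred P] :
    1 - ((s.filter P).card / s.card : ℝ) = (s.filter (¬ P ·)).card / s.card := by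
  have hcard : (s.card : ℝ) ≠ 0 := Nat.cast_ne_zero.2 hs.card_ne_zero
  rw [eq_div_iff hcard, sub_mul, div_mul_cancel₀ _ hcard, one_mul, sub_eq_iff_eq_add']
  exact_mod_cast (Finset.card_filter_add_card_filter_not (s := s) P).symm

lemma prod_bernWeight_le_prod_bernWeight_card_div {p : ℝ} (hp : p ∈ Set.Icc 0 1) :
    ∏ t ∈ s, bernWeight p (b t)
      ≤ ∏ t ∈ s, bernWeight ((s.filter (b · = true)).card / s.card) (b t) := by
  rcases s.eq_empty_or_nonempty with rfl | hs
  · simp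
  have hN : (0 : ℝ) < s.card := Nat.cast_pos.2 hs.card_pos
  have hcard : (s.card : ℝ) = (s.filter (b · = true)).card + (s.filter (¬ b · = true)).card :=
    mod_cast (Finset.card_filter_add_card_filter_not (s := s) (b · = true)).symm
  simp only [prod_bernWeight_eq_pow_mul_pow, one_sub_card_filter_div_card s hs]
  set k := (s.filter (b · = true)).card
  set l := (s.filter (¬ b · = true)).card
  calc p ^ k * (1 - p) ^ l
      ≤ ((k / s.card) ^ k * Real.exp (s.card * p - k))
        * ((l / s.card) ^ l * Real.exp (s.card * (1 - p) - l)) :=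
        mul_le_mul (pow_le_div_pow_mul_exp hp.1 hN k)
          (pow_le_div_pow_mul_exp (sub_nonneg.2 hp.2) hN l)
          (pow_nonneg (sub_nonneg.2 hp.2) l) (by positivity)
    _ = (k / s.card) ^ k * (l / s.card) ^ l := by
        rw [mul_mul_mul_comm, ← Real.exp_add, hcard]
        ring_nf
        simp

lemma bernWeight_card_div_pos {t : α} (ht : t ∈ s) :
    0 < bernWeight ((s.filter (b · = true)).card / s.card) (b t) := by
  have hpos {P : α → Prop} [DecidablePred P] (hP : P t) : 0 < ((s.filter P).card / s.card : ℝ) :=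
    div_pos (Nat.cast_pos.2 (Finset.card_pos.2 ⟨t, Finset.mem_filter.2 ⟨ht, hP⟩⟩))
      (Nat.cast_pos.2 (Finset.card_pos.2 ⟨t, ht⟩))
  rw [bernWeight]
  split_ifs with hb
  · exact hpos hb
  · rw [one_sub_card_filter_div_card s ⟨t, ht⟩]
    exact hpos hb

end MaximumLikelihood

lemma HubParams.A_mem_Icc {nL n : ℕ} (θ : HubParams nL n) (i : Fin nL) (j : Fin n) :
    θ.A i j ∈ Set.Icc 0 1 :=
  ⟨θ.A_nonneg i j, θ.A_le_one i j⟩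

lemma HubParams.pos {nL n : ℕ} (θ : HubParams nL n) : 0 < nL := by
  obtain ⟨i, -, -⟩ := Finset.exists_ne_zero_of_sum_ne_zero (θ.ρ_sum.trans_ne one_ne_zero)
  exact i.pos

/-- The likelihood of the groups `g` given the labels `w`, when `B i j` is the probability that
node `j` joins a group of hub `i`. Unlike `condLogLik` it carries no junk values of `Real.log`. -/
def condLik {nL n T : ℕ} (g : Fin T → Fin n → Bool) (B : Fin nL → Fin n → ℝ)
    (w : Fin T → Fin nL) : ℝ :=
  ∏ t, ∏ j, bernWeight (B (w t) j) (g t j)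

section Likelihood

variable {nL n T : ℕ} (g : Fin T → Fin n → Bool) (w : Fin T → Fin nL)

lemma estA_eq_card_div_card (i : Fin nL) (j : Fin n) :
    estA g w i j = (((Finset.univ.filter (w · = i)).filter (g · j = true)).card : ℝ)
      / (Finset.univ.filter (w · = i)).card := by
  rw [estA, hubCount, Finset.sum_boole, Finset.filter_filter]
  simp only [and_comm]

lemma estA_mem_Icc (i : Fin nL) (j : Fin n) : estA g w i j ∈ Set.Icc 0 1 := by
  rw [estA_eq_card_div_card]
  exact card_filter_div_card_mem_Icc _ _

lemma condLik_eq_prod_fiberwise (B : Fin nL → Fin n → ℝ) :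
    condLik g B w = ∏ j, ∏ i, ∏ t ∈ Finset.univ.filter (w · = i), bernWeight (B i j) (g t j) := by
  rw [condLik, Finset.prod_comm]
  refine Finset.prod_congr rfl fun j _ => ?_
  rw [← Finset.prod_fiberwise Finset.univ w]
  refine Finset.prod_congr rfl fun i _ => Finset.prod_congr rfl fun t ht => ?_
  rw [(Finset.mem_filter.1 ht).2]

lemma condLik_le_condLik_estA {B : Fin nL → Fin n → ℝ} (hB : ∀ i j, B i j ∈ Set.Icc 0 1) :
    condLik g B w ≤ condLik g (estA g w) w := by
  simp only [condLik_eq_prod_fiberwise, estA_eq_card_div_card]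
  refine Finset.prod_le_prod (fun j _ => Finset.prod_nonneg fun i _ => Finset.prod_nonneg
    fun t _ => bernWeight_nonneg (hB i j) _) fun j _ => ?_
  exact Finset.prod_le_prod (fun i _ => Finset.prod_nonneg fun t _ => bernWeight_nonneg (hB i j) _)
    fun i _ => prod_bernWeight_le_prod_bernWeight_card_div _ (g · j) (hB i j)

lemma bernWeight_estA_pos (t : Fin T) (j : Fin n) : 0 < bernWeight (estA g w (w t) j) (g t j) := by
  rw [estA_eq_card_div_card]
  exact bernWeight_card_div_pos _ (g · j) (by simp)

lemma condLik_estA_pos : 0 < condLik g (estA g w) w :=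
  Finset.prod_pos fun t _ => Finset.prod_pos fun j _ => bernWeight_estA_pos g w t j

lemma profileLogLik_eq_log_condLik : profileLogLik g w = Real.log (condLik g (estA g w) w) := by
  have hpos := bernWeight_estA_pos g w
  rw [profileLogLik, condLogLik, condLik,
    Real.log_prod fun t _ => (Finset.prod_pos fun j _ => hpos t j).ne']
  refine Finset.sum_congr rfl fun t _ => ?_
  rw [Real.log_prod fun j _ => (hpos t j).ne']
  exact Finset.sum_congr rfl fun j _ => (apply_ite Real.log _ _ _).symm

variable {g w}

lemma IsProfileMLE.condLik_le {h : nL ≤ n} {z : Fin T → Fin nL} (hz : IsProfileMLE h g z)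
    (hw : Feasible h g w) {B : Fin nL → Fin n → ℝ} (hB : ∀ i j, B i j ∈ Set.Icc 0 1) :
    condLik g B w ≤ condLik g (estA g z) z := by
  have hmax := hz.2 w hw
  rw [profileLogLik_eq_log_condLik, profileLogLik_eq_log_condLik,
    Real.log_le_log_iff (condLik_estA_pos g w) (condLik_estA_pos g z)] at hmax
  exact (condLik_le_condLik_estA g w hB).trans hmax

lemma HubParams.feasible_of_condLik_ne_zero (θ : HubParams nL n) (hw : condLik g θ.A w ≠ 0) :
    Feasible θ.le g w := by
  intro t
  by_contra hg
  refine hw (Finset.prod_eq_zero (Finset.mem_univ t) (Finset.prod_eq_zero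
    (Finset.mem_univ (Fin.castLE θ.le (w t))) ?_))
  simp [bernWeight, hg, θ.A_self]

end Likelihood

lemma measureReal_iUnion_le_card_mul {Ω ι : Type*} [MeasurableSpace Ω] {μ : Measure Ω} [Fintype ι]
    {s : ι → Set Ω} {p : ℝ} (h : ∀ i, μ.real (s i) ≤ p) :
    μ.real (⋃ i, s i) ≤ Fintype.card ι * p :=
  (measureReal_iUnion_fintype_le s).trans <| by
    simpa using Finset.sum_le_card_nsmul Finset.univ _ p fun i _ => h i

section Tail

variable {Ω κ : Type*} [MeasurableSpace Ω] {μ : Measure Ω} [Fintype κ]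

lemma integrable_prod_of_iIndepFun {Y : κ → Ω → ℝ} (hY : iIndepFun Y μ)
    (hint : ∀ t, Integrable (Y t) μ) : Integrable (fun ω => ∏ t, Y t ω) μ := by
  have := hY.isProbabilityMeasure
  have hmeas : AEMeasurable (fun ω t => Y t ω) μ :=
    aemeasurable_pi_iff.2 fun t => (hint t).aemeasurable
  have hpi : Integrable (fun y : κ → ℝ => ∏ t, y t) (μ.map fun ω t => Y t ω) := by
    rw [hY.map_fun_eq_pi_map fun t => (hint t).aemeasurable]
    refine Integrable.fintype_prod (f := fun _ => id) fun t => ?_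
    exact (integrable_map_measure aestronglyMeasurable_id (hint t).aemeasurable).2 (hint t)
  exact hpi.comp_aemeasurable hmeas

lemma measureReal_le_prod_le_inv {Y : κ → Ω → ℝ} (hY : iIndepFun Y μ)
    (hint : ∀ t, Integrable (Y t) μ) (hnonneg : ∀ t ω, 0 ≤ Y t ω) (hle : ∀ t, ∫ ω, Y t ω ∂μ ≤ 1)
    {c : ℝ} (hc : 0 < c) : μ.real {ω | c ≤ ∏ t, Y t ω} ≤ c⁻¹ := by
  have hmarkov := mul_meas_ge_le_integral_of_nonneg
    (ae_of_all μ fun ω => Finset.prod_nonneg fun t _ => hnonneg t ω)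
    (integrable_prod_of_iIndepFun hY hint) c
  rw [hY.integral_fun_prod_eq_prod_integral fun t => (hint t).aestronglyMeasurable] at hmarkov
  rw [inv_eq_one_div, le_div_iff₀' hc]
  exact hmarkov.trans (Finset.prod_le_one (fun t _ => integral_nonneg (hnonneg t)) fun t _ => hle t)

lemma mgf_le_exp_of_abs_le_one {X : Ω → ℝ} [IsProbabilityMeasure μ] (hX : Measurable X)
    (hbdd : ∀ ω, |X ω| ≤ 1) {m σ s : ℝ} (hm : ∫ ω, X ω ∂μ ≤ m) (hσ : ∫ ω, X ω ^ 2 ∂μ ≤ σ)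
    (hs : s ∈ Set.Icc 0 1) : mgf X μ s ≤ Real.exp (s * m + s ^ 2 * σ) := by
  have hs0 := hs.1
  have hsX (ω : Ω) : |s * X ω| ≤ 1 := by
    rw [abs_mul, abs_of_nonneg hs0]
    exact mul_le_one₀ hs.2 (abs_nonneg _) (hbdd ω)
  have hexp (ω : Ω) : Real.exp (s * X ω) ≤ 1 + s * X ω + s ^ 2 * X ω ^ 2 := by
    linarith [(abs_le.1 (Real.abs_exp_sub_one_sub_id_le (hsX ω))).2, mul_pow s (X ω) 2]
  have hint : Integrable X μ := .of_bound hX.aestronglyMeasurable 1 (ae_of_all _ hbdd)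
  have hint1 : Integrable (fun ω => 1 + s * X ω) μ := (integrable_const 1).add (hint.const_mul s)
  have hint2 : Integrable (fun ω => s ^ 2 * X ω ^ 2) μ :=
    .const_mul (.of_bound (hX.pow_const 2).aestronglyMeasurable 1 (ae_of_all _ fun ω => by
      simpa [abs_pow] using pow_le_one₀ (n := 2) (abs_nonneg _) (hbdd ω))) _
  calc mgf X μ s
      ≤ ∫ ω, (1 + s * X ω + s ^ 2 * X ω ^ 2) ∂μ :=
        integral_mono (integrable_exp_mul_of_mem_Icc hX.aemeasurable
          (ae_of_all _ fun ω => abs_le.1 (hbdd ω))) (hint1.add hint2) hexp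
    _ = 1 + s * ∫ ω, X ω ∂μ + s ^ 2 * ∫ ω, X ω ^ 2 ∂μ := by
        rw [integral_add hint1 hint2, integral_add (integrable_const 1) (hint.const_mul s),
          integral_const_mul, integral_const_mul]
        simp
    _ ≤ 1 + s * m + s ^ 2 * σ := by gcongr
    _ ≤ Real.exp (s * m + s ^ 2 * σ) := by linarith [Real.add_one_le_exp (s * m + s ^ 2 * σ)]

-- Bernstein's inequality: the exponent is read off from Chernoff's bound at `s = τ / (2 σ)`.
lemma measureReal_le_sum_le_exp_of_abs_le_one {X : κ → Ω → ℝ} (hX : iIndepFun X μ)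
    (hmeas : ∀ t, Measurable (X t)) (hbdd : ∀ t ω, |X t ω| ≤ 1) {m σ τ : ℝ}
    (hm : ∀ t, ∫ ω, X t ω ∂μ ≤ m) (hσ : ∀ t, ∫ ω, X t ω ^ 2 ∂μ ≤ σ) (hσ0 : 0 < σ) (hτ : 0 ≤ τ)
    (hτσ : τ ≤ 2 * σ) :
    μ.real {ω | Fintype.card κ * (m + τ) ≤ ∑ t, X t ω}
      ≤ Real.exp (-(Fintype.card κ * (τ ^ 2 / (4 * σ)))) := by
  have := hX.isProbabilityMeasure
  set s := τ / (2 * σ) with hs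
  have hsmem : s ∈ Set.Icc 0 1 := ⟨by positivity, div_le_one_of_le₀ hτσ (by positivity)⟩
  have hint : Integrable (fun ω => Real.exp (s * (∑ t, X t) ω)) μ :=
    hX.integrable_exp_mul_sum hmeas fun t _ => integrable_exp_mul_of_mem_Icc
      (hmeas t).aemeasurable (ae_of_all _ fun ω => abs_le.1 (hbdd t ω))
  have hmgf : mgf (∑ t, X t) μ s ≤ Real.exp (s * m + s ^ 2 * σ) ^ Fintype.card κ := by
    rw [hX.mgf_sum hmeas]
    refine (Finset.prod_le_prod (fun t _ => mgf_nonneg) fun t _ =>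
      mgf_le_exp_of_abs_le_one (hmeas t) (hbdd t) (hm t) (hσ t) hsmem).trans_eq ?_
    rw [Finset.prod_const, Finset.card_univ]
  simp only [← Finset.sum_apply]
  refine (measure_ge_le_exp_mul_mgf _ hsmem.1 hint).trans ?_
  refine (mul_le_mul_of_nonneg_left hmgf (Real.exp_nonneg _)).trans_eq ?_
  rw [← Real.exp_nat_mul, ← Real.exp_add, hs]
  congr 1
  field_simp
  ring

end Tail

/-- The expectation of `f (z, G)` for one latent hub `z` and its group `G` in the hub model. -/
def HubParams.expect {nL n : ℕ} (θ : HubParams nL n) (f : Fin nL × (Fin n → Bool) → ℝ) : ℝ :=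
  ∑ i, θ.ρ i * ∑ g : Fin n → Bool, (∏ j, bernWeight (θ.A i j) (g j)) * f (i, g)

section Expect

variable {nL n : ℕ} (θ : HubParams nL n)

lemma HubParams.prod_bernWeight_nonneg (i : Fin nL) (g : Fin n → Bool) :
    0 ≤ ∏ j, bernWeight (θ.A i j) (g j) :=
  _root_.prod_bernWeight_nonneg (θ.A_mem_Icc i) g

lemma HubParams.expect_mono {f f' : Fin nL × (Fin n → Bool) → ℝ} (h : ∀ y, f y ≤ f' y) :
    θ.expect f ≤ θ.expect f' :=
  Finset.sum_le_sum fun i _ => mul_le_mul_of_nonneg_left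
    (Finset.sum_le_sum fun g _ => mul_le_mul_of_nonneg_left (h _)
      (θ.prod_bernWeight_nonneg i g)) (θ.ρ_nonneg i)

lemma HubParams.expect_neg (f : Fin nL × (Fin n → Bool) → ℝ) :
    (θ.expect fun y => -f y) = -θ.expect f := by
  simp only [expect, mul_neg, Finset.sum_neg_distrib]

lemma HubParams.expect_fst (f : Fin nL → ℝ) : (θ.expect fun y => f y.1) = ∑ i, θ.ρ i * f i := by
  simp only [expect, ← Finset.sum_mul, sum_prod_bernWeight, one_mul]

lemma HubParams.expect_fst_apply (j : Fin n) (f : Fin nL → Bool → ℝ) :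
    (θ.expect fun y => f y.1 (y.2 j))
      = ∑ i, θ.ρ i * (θ.A i j * f i true + (1 - θ.A i j) * f i false) := by
  exact Finset.sum_congr rfl fun i _ => congrArg _ <|
    (sum_prod_bernWeight_mul_apply (θ.A i) j (f i)).trans (sum_bernWeight_mul _ _)

end Expect

namespace IsHubSample

variable {nL n T : ℕ} {θ : HubParams nL n} {Ω : Type*} [MeasurableSpace Ω] {μ : Measure Ω}
  {z : Fin T → Ω → Fin nL} {G : Fin T → Ω → Fin n → Bool}

lemma measurable_pair (h : IsHubSample θ μ z G) (t : Fin T) :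
    Measurable fun ω => (z t ω, G t ω) :=
  (h.measurable_z t).prodMk (h.measurable_G t)

lemma integral_comp (h : IsHubSample θ μ z G) (t : Fin T) (f : Fin nL × (Fin n → Bool) → ℝ) :
    ∫ ω, f (z t ω, G t ω) ∂μ = θ.expect f := by
  have := h.indep.isProbabilityMeasure
  have hlaw (y : Fin nL × (Fin n → Bool)) : (μ.map fun ω => (z t ω, G t ω)).real {y}
      = θ.ρ y.1 * ∏ j, bernWeight (θ.A y.1 j) (y.2 j) := by
    rw [map_measureReal_apply (h.measurable_pair t) (measurableSet_singleton y)]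
    simpa only [Set.preimage, Set.mem_singleton_iff, Prod.ext_iff] using! h.law t y.1 y.2
  have := Measure.isProbabilityMeasure_map (μ := μ) (h.measurable_pair t).aemeasurable
  rw [← integral_map (h.measurable_pair t).aemeasurable
    (Measurable.of_discrete (f := f)).aestronglyMeasurable, integral_fintype .of_finite]
  simp only [hlaw, Fintype.sum_prod_type, smul_eq_mul, HubParams.expect, Finset.mul_sum, mul_assoc]

lemma iIndepFun_comp (h : IsHubSample θ μ z G) (f : Fin T → Fin nL × (Fin n → Bool) → ℝ) :
    iIndepFun (fun t ω => f t (z t ω, G t ω)) μ :=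
  h.indep.comp f fun _ => .of_discrete

lemma integrable_comp (h : IsHubSample θ μ z G) (t : Fin T) (f : Fin nL × (Fin n → Bool) → ℝ) :
    Integrable (fun ω => f (z t ω, G t ω)) μ := by
  have := h.indep.isProbabilityMeasure
  have := Measure.isProbabilityMeasure_map (μ := μ) (h.measurable_pair t).aemeasurable
  exact (Integrable.of_finite (f := f)).comp_measurable (h.measurable_pair t)

lemma ae_condLik_ne_zero (h : IsHubSample θ μ z G) :
    ∀ᵐ ω ∂μ, condLik (fun t => G t ω) θ.A (fun t => z t ω) ≠ 0 := by
  have := h.indep.isProbabilityMeasure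
  have hpair : ∀ᵐ ω ∂μ, ∀ t, ∀ y : Fin nL × (Fin n → Bool), (z t ω, G t ω) = y →
      ∏ j, bernWeight (θ.A y.1 j) (y.2 j) ≠ 0 := by
    refine ae_all_iff.2 fun t => ae_all_iff.2 fun y => ?_
    by_cases hy : ∏ j, bernWeight (θ.A y.1 j) (y.2 j) = 0
    · have hnull : μ.real {ω | z t ω = y.1 ∧ G t ω = y.2} = 0 :=
        (h.law t y.1 y.2).trans (mul_eq_zero_of_right _ hy)
      filter_upwards [compl_mem_ae_iff.2 ((measureReal_eq_zero_iff).1 hnull)] with ω hω heq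
      exact absurd (Prod.ext_iff.1 heq) hω
    · exact ae_of_all _ fun ω _ => hy
  filter_upwards [hpair] with ω hω
  exact Finset.prod_ne_zero_iff.2 fun t _ => hω t _ rfl

lemma measureReal_le_sum_comp_le_exp (h : IsHubSample θ μ z G) {f : Fin nL × (Fin n → Bool) → ℝ}
    (hf : ∀ y, |f y| ≤ 1) {m σ τ : ℝ} (hm : θ.expect f ≤ m)
    (hσ : θ.expect (fun y => f y ^ 2) ≤ σ) (hσ0 : 0 < σ) (hτ : 0 ≤ τ) (hτσ : τ ≤ 2 * σ) :
    μ.real {ω | T * (m + τ) ≤ ∑ t, f (z t ω, G t ω)} ≤ Real.exp (-(T * (τ ^ 2 / (4 * σ)))) := by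
  simpa only [Fintype.card_fin] using measureReal_le_sum_le_exp_of_abs_le_one
    (h.iIndepFun_comp fun _ => f) (fun t => Measurable.of_discrete.comp (h.measurable_pair t))
    (fun t ω => hf _) (fun t => (h.integral_comp t f).trans_le hm)
    (fun t => (h.integral_comp t fun y => f y ^ 2).trans_le hσ) hσ0 hτ hτσ

end IsHubSample

/-- The squared distance between the success probabilities which the parameters `A` with labels `w`
and the parameters `B` with labels `z` give to all the entries of the groups. -/
def sqDist {nL n T : ℕ} (A : Fin nL → Fin n → ℝ) (w : Fin T → Fin nL) (B : Fin nL → Fin n → ℝ)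
    (z : Fin T → Fin nL) : ℝ :=
  ∑ t, ∑ j, (A (w t) j - B (z t) j) ^ 2

lemma prod_prod_sqrt_bernWeight_div {nL n T : ℕ} (g : Fin T → Fin n → Bool)
    {A B : Fin nL → Fin n → ℝ} (hA : ∀ i j, A i j ∈ Set.Icc 0 1) (hB : ∀ i j, B i j ∈ Set.Icc 0 1)
    (w z : Fin T → Fin nL) :
    ∏ t, ∏ j, √(bernWeight (B (z t) j) (g t j) / bernWeight (A (w t) j) (g t j))
      = √(condLik g B z / condLik g A w) := by
  have hnonneg (t : Fin T) (j : Fin n) :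
      0 ≤ bernWeight (B (z t) j) (g t j) / bernWeight (A (w t) j) (g t j) :=
    div_nonneg (bernWeight_nonneg (hB _ _) _) (bernWeight_nonneg (hA _ _) _)
  simp only [condLik, ← Finset.prod_div_distrib]
  rw [Real.sqrt_prod _ fun t _ => Finset.prod_nonneg fun j _ => hnonneg t j]
  exact Finset.prod_congr rfl fun t _ => (Real.sqrt_prod _ fun j _ => hnonneg t j).symm

lemma HubParams.expect_exp_mul_prod_sqrt_div_le_one {nL n : ℕ} (θ : HubParams nL n)
    {q : Fin n → ℝ} (hq : ∀ j, q j ∈ Set.Icc 0 1) :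
    (θ.expect fun y => Real.exp ((∑ j, (θ.A y.1 j - q j) ^ 2) / 4)
      * ∏ j, √(bernWeight (q j) (y.2 j) / bernWeight (θ.A y.1 j) (y.2 j))) ≤ 1 := by
  rw [expect, ← θ.ρ_sum]
  refine Finset.sum_le_sum fun i _ => mul_le_of_le_one_right (θ.ρ_nonneg i) ?_
  simp only [mul_left_comm _ (Real.exp _), ← Finset.mul_sum]
  refine (mul_le_mul_of_nonneg_left (sum_prod_bernWeight_mul_prod_sqrt_div_le (θ.A_mem_Icc i) hq)
    (Real.exp_nonneg _)).trans_eq ?_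
  rw [← Real.exp_add, neg_div, add_neg_cancel, Real.exp_zero]

lemma card_image_estA_le {nL T : ℕ} (n : ℕ) (z : Fin T → Fin nL) :
    (Finset.univ.image fun g : Fin T → Fin n → Bool => estA g z).card ≤ (T + 1) ^ (nL * n) := by
  classical
  have hsub : (Finset.univ.image fun g : Fin T → Fin n → Bool => estA g z) ⊆
      Finset.univ.image fun (k : Fin nL × Fin n → Fin (T + 1)) i j =>
        ((k (i, j) : ℕ) / hubCount z i : ℝ) := by
    simp only [Finset.subset_iff, Finset.mem_image, Finset.mem_univ, true_and]
    rintro _ ⟨g, rfl⟩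
    refine ⟨fun p => ⟨(Finset.univ.filter fun t => g t p.2 = true ∧ z t = p.1).card,
      Nat.lt_succ_of_le ((Finset.card_filter_le _ _).trans_eq (Finset.card_fin T))⟩, ?_⟩
    funext i j
    simp only [estA, Finset.sum_boole]
  exact (Finset.card_le_card hsub).trans (Finset.card_image_le.trans_eq (by simp))

namespace IsHubSample

variable {nL n T : ℕ} {θ : HubParams nL n} {Ω : Type*} [MeasurableSpace Ω] {μ : Measure Ω}
  {z : Fin T → Ω → Fin nL} {G : Fin T → Ω → Fin n → Bool}

lemma measureReal_condLik_le_le_exp (h : IsHubSample θ μ z G) {B : Fin nL → Fin n → ℝ}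
    (hB : ∀ i j, B i j ∈ Set.Icc 0 1) (z' : Fin T → Fin nL) (E : ℝ) :
    μ.real {ω | E ≤ sqDist θ.A (z · ω) B z' ∧ 0 < condLik (G · ω) θ.A (z · ω)
        ∧ condLik (G · ω) θ.A (z · ω) ≤ condLik (G · ω) B z'} ≤ Real.exp (-(E / 4)) := by
  have := h.indep.isProbabilityMeasure
  let F (t : Fin T) (y : Fin nL × (Fin n → Bool)) : ℝ :=
    Real.exp ((∑ j, (θ.A y.1 j - B (z' t) j) ^ 2) / 4)
      * ∏ j, √(bernWeight (B (z' t) j) (y.2 j) / bernWeight (θ.A y.1 j) (y.2 j))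
  have hprod (ω : Ω) : ∏ t, F t (z t ω, G t ω) = Real.exp (sqDist θ.A (z · ω) B z' / 4)
      * √(condLik (G · ω) B z' / condLik (G · ω) θ.A (z · ω)) := by
    rw [← prod_prod_sqrt_bernWeight_div _ θ.A_mem_Icc hB, sqDist, Finset.sum_div, Real.exp_sum,
      ← Finset.prod_mul_distrib]
  rw [Real.exp_neg]
  refine (measureReal_mono ?_).trans (measureReal_le_prod_le_inv (h.iIndepFun_comp F)
    (fun t => h.integrable_comp t (F t)) (fun t ω => by positivity)
    (fun t => (h.integral_comp t (F t)).trans_le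
      (θ.expect_exp_mul_prod_sqrt_div_le_one (hB (z' t)))) (Real.exp_pos (E / 4)))
  rintro ω ⟨hE, hpos, hle⟩
  simp only [Set.mem_ofPred_eq, hprod]
  calc Real.exp (E / 4) ≤ Real.exp (sqDist θ.A (z · ω) B z' / 4) := by gcongr
    _ ≤ _ := le_mul_of_one_le_right (Real.exp_nonneg _)
      (Real.one_le_sqrt.2 ((one_le_div hpos).2 hle))

-- `estA (G · ω) z'` takes at most `(T + 1) ^ (nL * n)` values, so a union bound over them and over
-- the labels `z'` removes the dependence of the estimator on the sample.
lemma measureReal_exists_condLik_le_condLik_estA_le (h : IsHubSample θ μ z G) (E : ℝ) :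
    μ.real {ω | ∃ z', E ≤ sqDist θ.A (z · ω) (estA (G · ω) z') z'
        ∧ 0 < condLik (G · ω) θ.A (z · ω)
        ∧ condLik (G · ω) θ.A (z · ω) ≤ condLik (G · ω) (estA (G · ω) z') z'}
      ≤ (nL : ℝ) ^ T * ((T : ℝ) + 1) ^ (nL * n) * Real.exp (-(E / 4)) := by
  have := h.indep.isProbabilityMeasure
  let bad (z' : Fin T → Fin nL) (B : Fin nL → Fin n → ℝ) : Set Ω :=
    {ω | E ≤ sqDist θ.A (z · ω) B z' ∧ 0 < condLik (G · ω) θ.A (z · ω)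
      ∧ condLik (G · ω) θ.A (z · ω) ≤ condLik (G · ω) B z'}
  let values (z' : Fin T → Fin nL) := Finset.univ.image fun g : Fin T → Fin n → Bool => estA g z'
  have hbad (z' : Fin T → Fin nL) : μ.real (⋃ B ∈ values z', bad z' B)
      ≤ ((T : ℝ) + 1) ^ (nL * n) * Real.exp (-(E / 4)) := by
    refine (measureReal_biUnion_finset_le _ _).trans ?_
    refine (Finset.sum_le_card_nsmul _ _ (Real.exp (-(E / 4))) fun B hB => ?_).trans ?_
    · obtain ⟨g, -, rfl⟩ := Finset.mem_image.1 hB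
      exact h.measureReal_condLik_le_le_exp (estA_mem_Icc g z') z' E
    · rw [nsmul_eq_mul]
      gcongr
      exact_mod_cast card_image_estA_le n z'
  refine (measureReal_mono (s₂ := ⋃ z', ⋃ B ∈ values z', bad z' B) ?_).trans ?_
  · rintro ω ⟨z', hω⟩
    exact Set.mem_iUnion.2 ⟨z', Set.mem_biUnion
      (Finset.mem_image_of_mem _ (Finset.mem_univ (G · ω))) hω⟩
  · refine (measureReal_iUnion_le_card_mul hbad).trans_eq ?_
    simp [mul_assoc]

end IsHubSample

/-- The number of groups of hub `i` which get the label `k`, when `w` are the true and `z` the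
assigned labels. -/
def confusion {nL T : ℕ} (w z : Fin T → Fin nL) (i k : Fin nL) : ℕ :=
  (Finset.univ.filter fun t => w t = i ∧ z t = k).card

/-- The number of groups on which two label assignments disagree. -/
def labelErr {nL T : ℕ} (w z : Fin T → Fin nL) : ℕ :=
  (Finset.univ.filter fun t => w t ≠ z t).card

section Confusion

variable {nL n T : ℕ} (w z : Fin T → Fin nL)

lemma sum_eq_sum_confusion_mul (f : Fin nL → Fin nL → ℝ) :
    ∑ t, f (w t) (z t) = ∑ k, ∑ i, confusion w z i k * f i k := by
  rw [Finset.sum_comm, ← Fintype.sum_prod_type', ← Finset.sum_fiberwise Finset.univ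
    fun t => (w t, z t)]
  refine Finset.sum_congr rfl fun p _ => ?_
  simp only [confusion, ← nsmul_eq_mul, ← Finset.sum_const, Prod.ext_iff]
  exact Finset.sum_congr rfl fun t ht => by rw [(Finset.mem_filter.1 ht).2.1,
    (Finset.mem_filter.1 ht).2.2]

lemma hubCount_eq_sum_confusion (k : Fin nL) : hubCount z k = ∑ i, confusion w z i k := by
  rw [hubCount, Finset.card_eq_sum_card_fiberwise fun t _ => Finset.mem_univ (w t)]
  simp only [confusion, Finset.filter_filter, and_comm]

lemma labelErr_eq_sum_confusion :
    labelErr w z = ∑ i, ∑ k ∈ Finset.univ.erase i, confusion w z i k := by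
  rw [labelErr, Finset.card_eq_sum_card_fiberwise fun t _ => Finset.mem_univ (w t)]
  refine Finset.sum_congr rfl fun i _ => ?_
  rw [Finset.card_eq_sum_card_fiberwise (f := z) (t := Finset.univ.erase i)]
  · refine Finset.sum_congr rfl fun k hk => ?_
    simp only [confusion, Finset.filter_filter]
    congr 1
    ext t
    grind
  · intro t ht
    simp only [Finset.coe_filter, Finset.mem_filter, Finset.mem_univ, true_and] at ht
    simpa [← ht.2] using ht.1.symm

end Confusion

section Separation

lemma mul_sq_mul_le_mul_sq_add_mul_sq {a c x y d κ : ℝ} (ha : 0 ≤ a) (hc : 0 ≤ c) (hd : 0 ≤ d)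
    (hxy : d ≤ x - y) (hκ : κ * (a + c) ≤ c) : κ * d ^ 2 * a ≤ a * x ^ 2 + c * y ^ 2 := by
  rcases (add_nonneg ha hc).eq_or_lt with h | h
  · have ha0 : a = 0 := by linarith
    have hc0 : c = 0 := by linarith
    simp [ha0, hc0]
  · have hsq : d ^ 2 ≤ (x - y) ^ 2 := pow_le_pow_left₀ hd hxy 2
    refine le_of_mul_le_mul_left ?_ h
    calc (a + c) * (κ * d ^ 2 * a) = κ * (a + c) * (a * d ^ 2) := by ring
      _ ≤ c * (a * d ^ 2) := mul_le_mul_of_nonneg_right hκ (by positivity)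
      _ ≤ c * (a * (x - y) ^ 2) := by gcongr
      _ ≤ (a + c) * (a * x ^ 2 + c * y ^ 2) := by nlinarith [sq_nonneg (a * x + c * y)]

variable {nL n T : ℕ} {w z : Fin T → Fin nL} {κ d : ℝ}

lemma mul_sq_mul_sum_confusion_le (hκ0 : 0 ≤ κ) (hκ : ∀ k, κ * hubCount z k ≤ confusion w z k k)
    (hd : 0 ≤ d) {a : Fin nL → ℝ} {i : Fin nL} (ha : ∀ k, k ≠ i → d ≤ a i - a k)
    (b : Fin nL → ℝ) :
    κ * d ^ 2 * ∑ k ∈ Finset.univ.erase i, (confusion w z i k : ℝ)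
      ≤ ∑ t, (a (w t) - b (z t)) ^ 2 := by
  rw [sum_eq_sum_confusion_mul w z fun i k => (a i - b k) ^ 2, Finset.mul_sum]
  have hnonneg (k i' : Fin nL) : 0 ≤ confusion w z i' k * (a i' - b k) ^ 2 := by positivity
  refine (Finset.sum_le_sum fun k hk => ?_).trans (Finset.sum_le_sum_of_subset_of_nonneg
    (Finset.subset_univ _) fun k _ _ => Finset.sum_nonneg fun i' _ => hnonneg k i')
  have hki : k ≠ i := Finset.ne_of_mem_erase hk
  have hcount : κ * (confusion w z i k + confusion w z k k) ≤ confusion w z k k := by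
    refine (mul_le_mul_of_nonneg_left ?_ hκ0).trans (hκ k)
    rw [hubCount_eq_sum_confusion w z k]
    exact_mod_cast Finset.add_le_sum (f := (confusion w z · k)) (fun _ _ => Nat.zero_le _)
      (Finset.mem_univ i) (Finset.mem_univ k) hki.symm
  calc κ * d ^ 2 * confusion w z i k
      ≤ confusion w z i k * (a i - b k) ^ 2 + confusion w z k k * (a k - b k) ^ 2 :=
        mul_sq_mul_le_mul_sq_add_mul_sq (Nat.cast_nonneg _) (Nat.cast_nonneg _) hd
          (by linarith [ha k hki]) hcount
    _ ≤ ∑ i', confusion w z i' k * (a i' - b k) ^ 2 :=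
        Finset.add_le_sum (f := fun i' => confusion w z i' k * (a i' - b k) ^ 2)
          (fun i' _ => hnonneg k i') (Finset.mem_univ i) (Finset.mem_univ k) hki.symm

lemma HubsSeparated.mul_labelErr_le_sqDist {θ : HubParams nL n} {v : ℝ}
    (hsep : HubsSeparated θ d v) (hd : 0 < d) (hκ0 : 0 ≤ κ)
    (hκ : ∀ k, κ * hubCount z k ≤ confusion w z k k) (B : Fin nL → Fin n → ℝ) :
    κ * d ^ 2 * (v * n / nL) * labelErr w z ≤ sqDist θ.A w B z := by
  obtain ⟨V, hV⟩ := hsep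
  let wrong (i : Fin nL) : ℝ := ∑ k ∈ Finset.univ.erase i, (confusion w z i k : ℝ)
  have (i : Fin nL) : 0 ≤ wrong i := by positivity
  have hdisj : Set.PairwiseDisjoint (Finset.univ : Finset (Fin nL)) V := by
    intro i _ k _ hik
    refine Finset.disjoint_left.2 fun j hji hjk => ?_
    linarith [(hV i).2 j hji k hik.symm, (hV k).2 j hjk i hik]
  calc κ * d ^ 2 * (v * n / nL) * labelErr w z
      = ∑ i, v * n / nL * (κ * d ^ 2 * wrong i) := by
        rw [labelErr_eq_sum_confusion, ← Finset.mul_sum, ← Finset.mul_sum]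
        push_cast
        ring
    _ ≤ ∑ i, (V i).card * (κ * d ^ 2 * wrong i) := by
        gcongr with i
        exact (hV i).1
    _ ≤ ∑ i, ∑ j ∈ V i, ∑ t, (θ.A (w t) j - B (z t) j) ^ 2 := by
        gcongr with i
        rw [← nsmul_eq_mul, ← Finset.sum_const]
        gcongr with j hj
        exact mul_sq_mul_sum_confusion_le (a := (θ.A · j)) hκ0 hκ hd.le ((hV i).2 j hj) (B · j)
    _ = ∑ j ∈ Finset.univ.biUnion V, ∑ t, (θ.A (w t) j - B (z t) j) ^ 2 :=
        (Finset.sum_biUnion hdisj).symm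
    _ ≤ ∑ j, ∑ t, (θ.A (w t) j - B (z t) j) ^ 2 :=
        Finset.sum_le_sum_of_subset_of_nonneg (Finset.subset_univ _) fun j _ _ => by positivity
    _ = sqDist θ.A w B z := Finset.sum_comm

end Separation

section EstimatorError

variable {nL n T : ℕ} (g : Fin T → Fin n → Bool) (w z : Fin T → Fin nL) (i : Fin nL) (j : Fin n)

lemma sum_ite_sub_estA_eq_zero :
    ∑ t, (if z t = i then (if g t j = true then 1 else 0) - estA g z i j else 0) = 0 := by
  have hmean : (hubCount z i : ℝ) * estA g z i j
      = ∑ t, if g t j = true ∧ z t = i then (1 : ℝ) else 0 := by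
    refine mul_div_cancel_of_imp' fun h => ?_
    have hlabel : ∀ t, z t ≠ i := by
      simpa [hubCount, Finset.filter_eq_empty_iff] using h
    simp [hlabel]
  have hcount : (hubCount z i : ℝ) * estA g z i j = ∑ t, if z t = i then estA g z i j else 0 := by
    simp [← Finset.sum_filter, hubCount]
  rw [← sub_eq_zero.2 (hmean.symm.trans hcount), ← Finset.sum_sub_distrib]
  refine Finset.sum_congr rfl fun t _ => ?_
  split_ifs <;> simp_all

lemma abs_estA_sub_mul_hubCount_le (p : ℝ) :
    |estA g z i j - p| * hubCount w i ≤ labelErr w z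
      + |∑ t, if w t = i then (if g t j = true then 1 else 0) - p else 0| := by
  set a := estA g z i j
  let x (t : Fin T) : ℝ := if g t j = true then 1 else 0
  have hx (t : Fin T) : |x t - a| ≤ 1 := by
    have := estA_mem_Icc g z i j
    rw [abs_le]
    constructor <;> simp only [x] <;> split_ifs <;> linarith [this.1, this.2]
  have hnormal : ∑ t, (if z t = i then x t - a else 0) = 0 := sum_ite_sub_estA_eq_zero g z i j
  have hcount : (a - p) * hubCount w i = ∑ t, if w t = i then a - p else 0 := by
    rw [hubCount, ← Finset.sum_filter, Finset.sum_const, nsmul_eq_mul, mul_comm]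
  have hsplit : (a - p) * hubCount w i
      = ∑ t, ((if z t = i then x t - a else 0) - if w t = i then x t - a else 0)
        + ∑ t, if w t = i then x t - p else 0 := by
    rw [hcount, Finset.sum_sub_distrib, hnormal, zero_sub, neg_add_eq_sub,
      ← Finset.sum_sub_distrib]
    refine Finset.sum_congr rfl fun t _ => ?_
    split_ifs <;> ring
  have herr : |∑ t, ((if z t = i then x t - a else 0) - if w t = i then x t - a else 0)|
      ≤ labelErr w z := by
    rw [labelErr, ← Finset.sum_boole]
    refine (Finset.abs_sum_le_sum_abs _ _).trans (Finset.sum_le_sum fun t _ => ?_)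
    by_cases hlabel : w t = z t
    · simp [hlabel]
    · rw [if_pos hlabel]
      split_ifs <;> simp [hx t, abs_sub_comm a (x t)]
  rw [← abs_of_nonneg (Nat.cast_nonneg (α := ℝ) (hubCount w i)), ← abs_mul, hsplit]
  exact (abs_add_le _ _).trans (by gcongr)

end EstimatorError

/-- The indicator that hub `i` forms the group and that no other hub belongs to it. A feasible
assignment has to label such a group correctly. -/
noncomputable def soleHub {nL n : ℕ} (h : nL ≤ n) (i : Fin nL) (y : Fin nL × (Fin n → Bool)) : ℝ :=
  if y.1 = i ∧ ∀ k, k ≠ i → y.2 (Fin.castLE h k) = false then 1 else 0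

/-- The indicator that hub `k` belongs to the group. -/
noncomputable def hubMember {nL n : ℕ} (h : nL ≤ n) (k : Fin nL)
    (y : Fin nL × (Fin n → Bool)) : ℝ :=
  if y.2 (Fin.castLE h k) = true then 1 else 0

/-- The centered membership of node `j` in a group formed by hub `i`, and `0` if another hub forms
the group. -/
noncomputable def hubDev {nL n : ℕ} (θ : HubParams nL n) (i : Fin nL) (j : Fin n)
    (y : Fin nL × (Fin n → Bool)) : ℝ :=
  if y.1 = i then (if y.2 j = true then 1 else 0) - θ.A i j else 0

section GroupStatistics

variable {nL n T : ℕ}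

lemma soleHub_sq (h : nL ≤ n) (i : Fin nL) (y : Fin nL × (Fin n → Bool)) :
    soleHub h i y ^ 2 = soleHub h i y := by
  simp [soleHub]

lemma soleHub_le_ite (h : nL ≤ n) (i : Fin nL) (y : Fin nL × (Fin n → Bool)) :
    soleHub h i y ≤ if y.1 = i then 1 else 0 := by
  rw [soleHub]
  split_ifs <;> simp_all

lemma abs_soleHub_le_one (h : nL ≤ n) (i : Fin nL) (y : Fin nL × (Fin n → Bool)) :
    |soleHub h i y| ≤ 1 := by
  rw [soleHub]
  split_ifs <;> simp

lemma abs_hubMember_le_one (h : nL ≤ n) (k : Fin nL) (y : Fin nL × (Fin n → Bool)) :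
    |hubMember h k y| ≤ 1 := by
  rw [hubMember]
  split_ifs <;> simp

lemma hubMember_sq (h : nL ≤ n) (k : Fin nL) (y : Fin nL × (Fin n → Bool)) :
    hubMember h k y ^ 2 = hubMember h k y := by
  simp [hubMember]

variable (θ : HubParams nL n)

lemma abs_hubDev_le_ite (i : Fin nL) (j : Fin n) (y : Fin nL × (Fin n → Bool)) :
    |hubDev θ i j y| ≤ if y.1 = i then 1 else 0 := by
  have := θ.A_mem_Icc i j
  rw [hubDev]
  split_ifs
  · simpa [abs_of_nonneg (sub_nonneg.2 this.2)] using this.1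
  · simpa [abs_of_nonneg this.1] using this.2
  · simp

lemma abs_hubDev_le_one (i : Fin nL) (j : Fin n) (y : Fin nL × (Fin n → Bool)) :
    |hubDev θ i j y| ≤ 1 :=
  (abs_hubDev_le_ite θ i j y).trans (by split_ifs <;> simp)

lemma hubDev_sq_le_ite (i : Fin nL) (j : Fin n) (y : Fin nL × (Fin n → Bool)) :
    hubDev θ i j y ^ 2 ≤ if y.1 = i then 1 else 0 :=
  (sq_abs (hubDev θ i j y)).symm.trans_le <|
    (pow_le_pow_left₀ (abs_nonneg _) (abs_hubDev_le_ite θ i j y) 2).trans_eq (by simp)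

lemma expect_soleHub (i : Fin nL) : θ.expect (soleHub θ.le i)
    = θ.ρ i * ∏ k ∈ Finset.univ.erase i, (1 - θ.A i (Fin.castLE θ.le k)) := by
  have hmap (g : Fin n → Bool) : (∀ k, k ≠ i → g (Fin.castLE θ.le k) = false) ↔
      ∀ j ∈ (Finset.univ.erase i).map (Fin.castLEEmb θ.le), g j = false := by
    simp only [Finset.forall_mem_map, Finset.mem_erase, Finset.mem_univ, and_true,
      Fin.castLEEmb_apply]
  rw [HubParams.expect, Finset.sum_eq_single i (fun i' _ hi' => by simp [soleHub, hi']) (by simp)]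
  simp only [soleHub, true_and, hmap]
  have hprod := sum_prod_bernWeight_mul_ite_forall_eq_false (θ.A i)
    ((Finset.univ.erase i).map (Fin.castLEEmb θ.le))
  simp only [Finset.prod_map, Fin.castLEEmb_apply] at hprod
  rw [← hprod]
  congr!

lemma expect_ite_fst_eq (i : Fin nL) : (θ.expect fun y => if y.1 = i then 1 else 0) = θ.ρ i := by
  simp [θ.expect_fst fun k => if k = i then 1 else 0]

lemma expect_hubMember (k : Fin nL) :
    θ.expect (hubMember θ.le k) = ∑ i, θ.ρ i * θ.A i (Fin.castLE θ.le k) := by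
  refine (θ.expect_fst_apply (Fin.castLE θ.le k) fun _ b => if b = true then 1 else 0).trans ?_
  simp

lemma expect_hubDev (i : Fin nL) (j : Fin n) : θ.expect (hubDev θ i j) = 0 := by
  refine (θ.expect_fst_apply j fun i' b =>
    if i' = i then (if b = true then 1 else 0) - θ.A i j else 0).trans
    (Finset.sum_eq_zero fun i' _ => ?_)
  by_cases hi : i' = i
  · subst hi
    simp only [if_true, Bool.false_eq_true, if_false]
    ring
  · simp [hi]

lemma ρ_le_expect_hubMember (k : Fin nL) : θ.ρ k ≤ θ.expect (hubMember θ.le k) := by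
  rw [expect_hubMember]
  refine le_of_eq_of_le ?_ (Finset.single_le_sum (f := fun i => θ.ρ i * θ.A i (Fin.castLE θ.le k))
    (fun i _ => mul_nonneg (θ.ρ_nonneg i) (θ.A_nonneg _ _)) (Finset.mem_univ k))
  simp [θ.A_self]

variable {θ} {g : Fin T → Fin n → Bool} {z : Fin T → Fin nL}

lemma Feasible.sum_soleHub_le_confusion {h : nL ≤ n} (hz : Feasible h g z) (w : Fin T → Fin nL)
    (i : Fin nL) : ∑ t, soleHub h i (w t, g t) ≤ confusion w z i i := by
  rw [confusion, ← Finset.sum_boole]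
  refine Finset.sum_le_sum fun t _ => ?_
  have hlabel (hg : ∀ k, k ≠ i → g t (Fin.castLE h k) = false) : z t = i := by
    by_contra hne
    exact Bool.false_ne_true ((hg _ hne).symm.trans (hz t))
  rw [soleHub]
  split_ifs with hsole hconf hconf
  · exact le_rfl
  · exact absurd ⟨hsole.1, hlabel hsole.2⟩ hconf
  · exact zero_le_one
  · exact le_rfl

lemma Feasible.hubCount_le_sum_hubMember {h : nL ≤ n} (hz : Feasible h g z) (w : Fin T → Fin nL)
    (k : Fin nL) : hubCount z k ≤ ∑ t, hubMember h k (w t, g t) := by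
  rw [hubCount, ← Finset.sum_boole]
  refine Finset.sum_le_sum fun t _ => ?_
  have hmem : z t = k → g t (Fin.castLE h k) = true := fun hk => hk ▸ hz t
  rw [hubMember]
  split_ifs <;> simp_all

end GroupStatistics

/-- In the model `θ` every hub is alone in its group with probability at least `c / nL` and belongs
to a group with probability at most `C / nL`. -/
structure HubParams.IsBalanced {nL n : ℕ} (θ : HubParams nL n) (c C : ℝ) : Prop where
  div_le_expect_soleHub : ∀ i, c / nL ≤ θ.expect (soleHub θ.le i)
  expect_hubMember_le_div : ∀ k, θ.expect (hubMember θ.le k) ≤ C / nL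

/-- The sample `w, g` of hub labels and groups has the frequencies which hold with high probability
in a model that is balanced with constants `c` and `C`, with the deviations of the memberships from
`A` controlled by `δ`. -/
structure IsTypical {nL n T : ℕ} (θ : HubParams nL n) (c C δ : ℝ) (w : Fin T → Fin nL)
    (g : Fin T → Fin n → Bool) : Prop where
  lt_sum_soleHub : ∀ i, c / 2 * (T / nL) < ∑ t, soleHub θ.le i (w t, g t)
  sum_hubMember_lt : ∀ k, ∑ t, hubMember θ.le k (w t, g t) < 3 * C * (T / nL)
  abs_sum_hubDev_lt : ∀ i j, |∑ t, hubDev θ i j (w t, g t)| < δ * (T / nL)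

section Typical

variable {nL n T : ℕ} {θ : HubParams nL n} {c C δ : ℝ}

lemma HubParams.IsBalanced.ρ_le_div (hθ : θ.IsBalanced c C) (k : Fin nL) : θ.ρ k ≤ C / nL :=
  (ρ_le_expect_hubMember θ k).trans (hθ.expect_hubMember_le_div k)

lemma HubParams.expect_soleHub_le_ρ (θ : HubParams nL n) (i : Fin nL) :
    θ.expect (soleHub θ.le i) ≤ θ.ρ i :=
  (θ.expect_mono (soleHub_le_ite θ.le i)).trans_eq (expect_ite_fst_eq θ i)

lemma HubParams.IsBalanced.le (hθ : θ.IsBalanced c C) : c ≤ C := by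
  have hnL : (0 : ℝ) < nL := Nat.cast_pos.2 θ.pos
  let i : Fin nL := ⟨0, θ.pos⟩
  exact (div_le_div_iff_of_pos_right hnL).1 <| (hθ.div_le_expect_soleHub i).trans <|
    (θ.expect_soleHub_le_ρ i).trans (hθ.ρ_le_div i)

section Deterministic

variable {w z : Fin T → Fin nL} {g : Fin T → Fin n → Bool}

lemma IsTypical.mul_hubCount_le_confusion (h : IsTypical θ c C δ w g) (hC : 0 < C) (hc : 0 ≤ c)
    (hz : Feasible θ.le g z) (k : Fin nL) : c / (6 * C) * hubCount z k ≤ confusion w z k k :=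
  calc c / (6 * C) * hubCount z k ≤ c / (6 * C) * (3 * C * (T / nL)) := by
        gcongr
        exact (hz.hubCount_le_sum_hubMember w k).trans (h.sum_hubMember_lt k).le
    _ = c / 2 * (T / nL) := by field_simp; ring
    _ ≤ confusion w z k k := (h.lt_sum_soleHub k).le.trans (hz.sum_soleHub_le_confusion w k)

lemma IsTypical.lt_hubCount (h : IsTypical θ c C δ w g) (i : Fin nL) :
    c / 2 * (T / nL) < hubCount w i := by
  refine (h.lt_sum_soleHub i).trans_le ?_
  rw [hubCount, ← Finset.sum_boole]
  exact Finset.sum_le_sum fun t _ => soleHub_le_ite θ.le i (w t, g t)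

lemma IsTypical.maxError_le (h : IsTypical θ c C δ w g) (hc : 0 < c) (hδ : 0 < δ)
    (herr : labelErr w z ≤ δ * (T / nL)) : maxError θ g z ≤ 4 * δ / c := by
  refine Real.iSup_le (fun ⟨i, j⟩ => ?_) (by positivity)
  have hr : 0 < (T : ℝ) / nL :=
    pos_of_mul_pos_right ((abs_nonneg _).trans_lt (h.abs_sum_hubDev_lt i j)) hδ.le
  have hcount : |estA g z i j - θ.A i j| * hubCount w i ≤ δ * (T / nL) + δ * (T / nL) :=
    (abs_estA_sub_mul_hubCount_le g w z i j (θ.A i j)).trans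
      (add_le_add herr (h.abs_sum_hubDev_lt i j).le)
  have hle : |estA g z i j - θ.A i j| * (c / 2 * (T / nL)) ≤ 4 * δ / c * (c / 2 * (T / nL)) :=
    (mul_le_mul_of_nonneg_left (h.lt_hubCount i).le (abs_nonneg _)).trans
      (hcount.trans_eq (by field_simp; ring))
  exact le_of_mul_le_mul_right hle (by positivity)

lemma IsTypical.mul_le_sqDist {d v : ℝ} (h : IsTypical θ c C δ w g) (hc : 0 ≤ c) (hC : 0 < C)
    (hsep : HubsSeparated θ d v) (hd : 0 < d) (hv : 0 ≤ v) (hz : Feasible θ.le g z)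
    (herr : δ * (T / nL) ≤ labelErr w z) (B : Fin nL → Fin n → ℝ) :
    c / (6 * C) * d ^ 2 * (v * n / nL) * (δ * (T / nL)) ≤ sqDist θ.A w B z :=
  (mul_le_mul_of_nonneg_left herr (by positivity)).trans <|
    hsep.mul_labelErr_le_sqDist hd (by positivity) (h.mul_hubCount_le_confusion hC hc hz) B

end Deterministic

namespace IsHubSample

variable {Ω : Type*} [MeasurableSpace Ω] {μ : Measure Ω}
  {z : Fin T → Ω → Fin nL} {G : Fin T → Ω → Fin n → Bool}

lemma measureReal_le_sum_comp_le_exp_div (h : IsHubSample θ μ z G)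
    {f : Fin nL × (Fin n → Bool) → ℝ} {a b : ℝ} (hf : ∀ y, |f y| ≤ 1)
    (hmean : θ.expect f ≤ a / nL) (hvar : θ.expect (fun y => f y ^ 2) ≤ C / nL) (hC : 0 < C)
    (hb : 0 ≤ b) (hbC : b ≤ 2 * C) :
    μ.real {ω | (a + b) * (T / nL) ≤ ∑ t, f (z t ω, G t ω)}
      ≤ Real.exp (-(b ^ 2 / (4 * C) * (T / nL))) := by
  have hnL : (0 : ℝ) < nL := Nat.cast_pos.2 θ.pos
  have key := h.measureReal_le_sum_comp_le_exp (τ := b / nL) hf hmean hvar (by positivity)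
    (by positivity) (by rw [← mul_div_assoc]; gcongr)
  have hthreshold : (T : ℝ) * (a / nL + b / nL) = (a + b) * (T / nL) := by ring
  have hexponent : (T : ℝ) * ((b / nL) ^ 2 / (4 * (C / nL))) = b ^ 2 / (4 * C) * (T / nL) := by
    field_simp
  rwa [hthreshold, hexponent] at key

lemma measureReal_sum_soleHub_le_le_exp (h : IsHubSample θ μ z G) (hθ : θ.IsBalanced c C)
    (hc : 0 < c) (i : Fin nL) :
    μ.real {ω | ∑ t, soleHub θ.le i (z t ω, G t ω) ≤ c / 2 * (T / nL)}
      ≤ Real.exp (-((c / 2) ^ 2 / (4 * C) * (T / nL))) := by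
  have key := h.measureReal_le_sum_comp_le_exp_div (f := fun y => -soleHub θ.le i y) (a := -c)
    (b := c / 2) (C := C) (fun y => (abs_neg _).trans_le (abs_soleHub_le_one θ.le i y))
    (by rw [θ.expect_neg, neg_div]; exact neg_le_neg (hθ.div_le_expect_soleHub i))
    (by simpa only [neg_sq, soleHub_sq] using (θ.expect_soleHub_le_ρ i).trans (hθ.ρ_le_div i))
    (hc.trans_le hθ.le) (by positivity) (by linarith [hθ.le])
  have hset : {ω | ∑ t, soleHub θ.le i (z t ω, G t ω) ≤ c / 2 * (T / nL)}
      = {ω | (-c + c / 2) * (T / nL) ≤ ∑ t, -soleHub θ.le i (z t ω, G t ω)} := by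
    ext ω
    simp only [Set.mem_ofPred_eq, Finset.sum_neg_distrib]
    constructor <;> intro <;> linarith
  rwa [hset]

lemma measureReal_le_sum_hubMember_le_exp (h : IsHubSample θ μ z G) (hθ : θ.IsBalanced c C)
    (hC : 0 < C) (k : Fin nL) :
    μ.real {ω | 3 * C * (T / nL) ≤ ∑ t, hubMember θ.le k (z t ω, G t ω)}
      ≤ Real.exp (-((2 * C) ^ 2 / (4 * C) * (T / nL))) := by
  have key := h.measureReal_le_sum_comp_le_exp_div (b := 2 * C) (abs_hubMember_le_one θ.le k)
    (hθ.expect_hubMember_le_div k)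
    (by simpa only [hubMember_sq] using hθ.expect_hubMember_le_div k) hC (by positivity) le_rfl
  rwa [show C + 2 * C = 3 * C by ring] at key

lemma measureReal_le_abs_sum_hubDev_le_exp (h : IsHubSample θ μ z G) (hρ : ∀ k, θ.ρ k ≤ C / nL)
    (hC : 0 < C) (hδ : 0 ≤ δ) (hδC : δ ≤ 2 * C) (i : Fin nL) (j : Fin n) :
    μ.real {ω | δ * (T / nL) ≤ |∑ t, hubDev θ i j (z t ω, G t ω)|}
      ≤ 2 * Real.exp (-(δ ^ 2 / (4 * C) * (T / nL))) := by
  have := h.indep.isProbabilityMeasure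
  have hvar : θ.expect (fun y => hubDev θ i j y ^ 2) ≤ C / nL :=
    (θ.expect_mono (hubDev_sq_le_ite θ i j)).trans ((expect_ite_fst_eq θ i).trans_le (hρ i))
  have upper := h.measureReal_le_sum_comp_le_exp_div (a := 0) (abs_hubDev_le_one θ i j)
    (by simp [expect_hubDev]) hvar hC hδ hδC
  have lower := h.measureReal_le_sum_comp_le_exp_div (a := 0) (f := fun y => -hubDev θ i j y)
    (fun y => (abs_neg _).trans_le (abs_hubDev_le_one θ i j y))
    (by simp [θ.expect_neg, expect_hubDev]) (by simpa only [neg_sq] using hvar) hC hδ hδC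
  simp only [zero_add, Finset.sum_neg_distrib] at upper lower
  simp only [le_abs, Set.ofPred_or, two_mul]
  exact (measureReal_union_le _ _).trans (add_le_add upper lower)

lemma measureReal_not_isTypical_le (h : IsHubSample θ μ z G) (hθ : θ.IsBalanced c C) (hδ : 0 < δ)
    (hδc : δ ≤ c / 2) :
    μ.real {ω | ¬IsTypical θ c C δ (z · ω) (G · ω)}
      ≤ 4 * n ^ 2 * Real.exp (-(δ ^ 2 / (4 * C) * (T / nL))) := by
  have := h.indep.isProbabilityMeasure
  have hc : 0 < c := by linarith
  have hcC : c ≤ C := hθ.le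
  have hC : 0 < C := hc.trans_le hcC
  set p := Real.exp (-(δ ^ 2 / (4 * C) * (T / nL))) with hp
  have : 0 ≤ p := (Real.exp_pos _).le
  have hexp {b : ℝ} (hb : δ ≤ b) : Real.exp (-(b ^ 2 / (4 * C) * (T / nL))) ≤ p := by
    rw [hp]
    gcongr
  have hsub : {ω | ¬IsTypical θ c C δ (z · ω) (G · ω)}
      ⊆ ((⋃ i, {ω | ∑ t, soleHub θ.le i (z t ω, G t ω) ≤ c / 2 * (T / nL)})
        ∪ ⋃ k, {ω | 3 * C * (T / nL) ≤ ∑ t, hubMember θ.le k (z t ω, G t ω)})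
        ∪ ⋃ q : Fin nL × Fin n, {ω | δ * (T / nL) ≤ |∑ t, hubDev θ q.1 q.2 (z t ω, G t ω)|} := by
    intro ω hω
    contrapose! hω
    simp only [Set.mem_union, Set.mem_iUnion, Set.mem_ofPred_eq, not_or, not_exists, not_le,
      Prod.forall] at hω
    exact not_not.2 ⟨hω.1.1, hω.1.2, hω.2⟩
  have hsole := measureReal_iUnion_le_card_mul fun i =>
    (h.measureReal_sum_soleHub_le_le_exp hθ hc i).trans (hexp hδc)
  have hmember := measureReal_iUnion_le_card_mul fun k =>
    (h.measureReal_le_sum_hubMember_le_exp hθ hC k).trans (hexp (by linarith))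
  have hdev := measureReal_iUnion_le_card_mul fun q : Fin nL × Fin n =>
    h.measureReal_le_abs_sum_hubDev_le_exp hθ.ρ_le_div hC hδ.le (by linarith) q.1 q.2
  simp only [Fintype.card_prod, Fintype.card_fin, Nat.cast_mul] at hsole hmember hdev
  have hnL : (nL : ℝ) ≤ n := Nat.cast_le.2 θ.le
  have hn : (n : ℝ) ≤ n ^ 2 := by exact_mod_cast Nat.le_self_pow two_ne_zero n
  calc _ ≤ nL * p + nL * p + nL * n * (2 * p) :=
        (measureReal_mono hsub).trans <| (measureReal_union_le _ _).trans <|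
          add_le_add ((measureReal_union_le _ _).trans (add_le_add hsole hmember)) hdev
    _ ≤ n ^ 2 * p + n ^ 2 * p + n * n * (2 * p) := by gcongr <;> exact hnL.trans hn
    _ = 4 * n ^ 2 * p := by ring

theorem measureReal_lt_maxError_le (h : IsHubSample θ μ z G) {d v : ℝ} {zhat : Ω → Fin T → Fin nL}
    (hzhat : ∀ᵐ ω ∂μ, IsProfileMLE θ.le (G · ω) (zhat ω)) (hθ : θ.IsBalanced c C)
    (hsep : HubsSeparated θ d v) (hd : 0 < d) (hv : 0 ≤ v) (hδ : 0 < δ) (hδc : δ ≤ c / 2) :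
    μ.real {ω | 4 * δ / c < maxError θ (G · ω) (zhat ω)}
      ≤ 4 * n ^ 2 * Real.exp (-(δ ^ 2 / (4 * C) * (T / nL)))
        + nL ^ T * (T + 1) ^ (nL * n)
          * Real.exp (-(c / (6 * C) * d ^ 2 * (v * n / nL) * (δ * (T / nL)) / 4)) := by
  have := h.indep.isProbabilityMeasure
  have hc : 0 < c := by linarith
  have hC : 0 < C := hc.trans_le hθ.le
  refine (ENNReal.toReal_mono (measure_ne_top _ _) (measure_mono_ae ?_)).trans <|
    (measureReal_union_le _ _).trans <| add_le_add (h.measureReal_not_isTypical_le hθ hδ hδc)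
      (h.measureReal_exists_condLik_le_condLik_estA_le _)
  filter_upwards [hzhat, h.ae_condLik_ne_zero] with ω hmle hlik herr
  refine or_iff_not_imp_left.2 fun htyp => ?_
  replace htyp := not_not.1 htyp
  have hlabel : δ * (T / nL) ≤ labelErr (z · ω) (zhat ω) := by
    by_contra! hlt
    exact (htyp.maxError_le hc hδ hlt.le).not_gt herr
  exact ⟨zhat ω, htyp.mul_le_sqDist hc.le hC hsep hd hv hmle.1 hlabel _,
    (Finset.prod_nonneg fun t _ => θ.prod_bernWeight_nonneg (z t ω) (G t ω)).lt_of_ne' hlik,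
    hmle.condLik_le (θ.feasible_of_condLik_ne_zero hlik) θ.A_mem_Icc⟩

end IsHubSample

end Typical

lemma exp_neg_div_one_sub_le_one_sub {x a : ℝ} (hx : 0 ≤ x) (hxa : x ≤ a) (ha : a < 1) :
    Real.exp (-(x / (1 - a))) ≤ 1 - x := by
  have hpos : 0 < 1 - x := by linarith
  calc Real.exp (-(x / (1 - a))) ≤ Real.exp (-(x / (1 - x))) := by gcongr
    _ = Real.exp (1 - (1 - x)⁻¹) := by congr 1; field_simp; ring
    _ ≤ Real.exp (Real.log (1 - x)) := Real.exp_le_exp.2 (Real.one_sub_inv_le_log_of_pos hpos)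
    _ = 1 - x := Real.exp_log hpos

section Balanced

variable {nL n : ℕ} {θ : HubParams nL n} {a c₀ cmin cmax : ℝ}

lemma HubParams.exp_neg_le_prod_one_sub_A (ha : a < 1) (hc₀ : 0 ≤ c₀)
    (hA : ∀ i i', i ≠ i' → θ.A i (Fin.castLE θ.le i') ≤ a ∧
      θ.A i (Fin.castLE θ.le i') ≤ c₀ / nL) (i : Fin nL) :
    Real.exp (-(c₀ / (1 - a))) ≤ ∏ k ∈ Finset.univ.erase i, (1 - θ.A i (Fin.castLE θ.le k)) := by
  have hnL : (0 : ℝ) < nL := Nat.cast_pos.2 θ.pos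
  have : 0 < 1 - a := sub_pos.2 ha
  have hsum : ∑ k ∈ Finset.univ.erase i, θ.A i (Fin.castLE θ.le k) ≤ c₀ :=
    calc ∑ k ∈ Finset.univ.erase i, θ.A i (Fin.castLE θ.le k)
        ≤ ∑ _ ∈ Finset.univ.erase i, c₀ / nL :=
          Finset.sum_le_sum fun k hk => (hA i k (Finset.ne_of_mem_erase hk).symm).2
      _ ≤ ∑ _ : Fin nL, c₀ / nL :=
          Finset.sum_le_sum_of_subset_of_nonneg (Finset.erase_subset _ _) fun _ _ _ => by positivity
      _ = c₀ := by simp [mul_div_cancel₀ _ hnL.ne']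
  calc Real.exp (-(c₀ / (1 - a)))
      ≤ Real.exp (∑ k ∈ Finset.univ.erase i, -(θ.A i (Fin.castLE θ.le k) / (1 - a))) := by
        rw [Finset.sum_neg_distrib, ← Finset.sum_div]
        gcongr
    _ ≤ ∏ k ∈ Finset.univ.erase i, (1 - θ.A i (Fin.castLE θ.le k)) := by
        rw [Real.exp_sum]
        exact Finset.prod_le_prod (fun _ _ => (Real.exp_pos _).le) fun k hk =>
          exp_neg_div_one_sub_le_one_sub (θ.A_nonneg _ _)
            (hA i k (Finset.ne_of_mem_erase hk).symm).1 ha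

lemma HubParams.isBalanced (ha : a < 1) (hc₀ : 0 ≤ c₀)
    (hA : ∀ i i', i ≠ i' → θ.A i (Fin.castLE θ.le i') ≤ a ∧
      θ.A i (Fin.castLE θ.le i') ≤ c₀ / nL)
    (hρ : ∀ i, cmin / nL ≤ θ.ρ i ∧ θ.ρ i ≤ cmax / nL) :
    θ.IsBalanced (cmin * Real.exp (-(c₀ / (1 - a)))) (cmax + c₀) where
  div_le_expect_soleHub i := by
    rw [expect_soleHub, mul_div_right_comm]
    exact mul_le_mul (hρ i).1 (exp_neg_le_prod_one_sub_A ha hc₀ hA i) (Real.exp_pos _).le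
      (θ.ρ_nonneg i)
  expect_hubMember_le_div k := by
    have hle (i : Fin nL) :
        θ.ρ i * θ.A i (Fin.castLE θ.le k) ≤ (if i = k then θ.ρ k else 0) + θ.ρ i * (c₀ / nL) := by
      split_ifs with hik
      · subst hik
        rw [θ.A_self, mul_one]
        exact le_add_of_nonneg_right (mul_nonneg (θ.ρ_nonneg i) (by positivity))
      · rw [zero_add]
        exact mul_le_mul_of_nonneg_left (hA i k hik).2 (θ.ρ_nonneg i)
    calc θ.expect (hubMember θ.le k)
        ≤ ∑ i, ((if i = k then θ.ρ k else 0) + θ.ρ i * (c₀ / nL)) := by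
          rw [expect_hubMember]
          exact Finset.sum_le_sum fun i _ => hle i
      _ = θ.ρ k + c₀ / nL := by
          rw [Finset.sum_add_distrib, ← Finset.sum_mul, θ.ρ_sum, one_mul]
          simp
      _ ≤ (cmax + c₀) / nL := by
          rw [add_div]
          exact add_le_add_left (hρ k).2 _

end Balanced

lemma tendsto_exp_sub_mul_of_div_tendsto_zero {f g : ℕ → ℝ} (hf : Tendsto f atTop atTop)
    (hfg : Tendsto (fun m => f m / g m) atTop (𝓝 0)) (hg : ∀ᶠ m in atTop, 0 < g m) {κ : ℝ}
    (hκ : 0 < κ) : Tendsto (fun m => Real.exp (f m - κ * g m)) atTop (𝓝 0) := by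
  refine Real.tendsto_exp_atBot.comp (tendsto_atBot_mono' _ ?_ (tendsto_neg_atTop_atBot.comp hf))
  filter_upwards [hfg.eventually_lt_const (half_pos hκ), hg] with m hm hgm
  rw [div_lt_iff₀ hgm] at hm
  simp only [Function.comp_apply]
  linarith

lemma natCast_pow_mul_add_one_pow_le_exp {k T : ℕ} (hk : 0 < k) (hT : 2 ≤ T) (N : ℕ) :
    (k : ℝ) ^ T * ((T : ℝ) + 1) ^ N ≤ Real.exp (T * Real.log k + 2 * N * Real.log T) := by
  have hT' : (0 : ℝ) < T := by positivity
  have hle : (T : ℝ) + 1 ≤ T ^ 2 := by exact_mod_cast (by nlinarith : T + 1 ≤ T ^ 2)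
  calc (k : ℝ) ^ T * ((T : ℝ) + 1) ^ N ≤ k ^ T * (T ^ 2) ^ N := by gcongr
    _ = Real.exp (Real.log k) ^ T * (Real.exp (Real.log T) ^ 2) ^ N := by
        rw [Real.exp_log (by positivity), Real.exp_log hT']
    _ = Real.exp (T * Real.log k + 2 * N * Real.log T) := by
        rw [← pow_mul, ← Real.exp_nat_mul, ← Real.exp_nat_mul, ← Real.exp_add]
        push_cast
        rfl

section Asymptotics

variable {nL n T : ℕ → ℕ} {d v : ℕ → ℝ}

lemma tendsto_sq_mul_exp_neg (hn : Tendsto n atTop atTop) (hT : Tendsto T atTop atTop)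
    (hnL : ∀ m, 0 < nL m)
    (h : Tendsto (fun m => (nL m : ℝ) * Real.log (n m) / T m) atTop (𝓝 0)) {κ : ℝ} (hκ : 0 < κ) :
    Tendsto (fun m => 4 * (n m : ℝ) ^ 2 * Real.exp (-(κ * (T m / nL m)))) atTop (𝓝 0) := by
  have hlog : Tendsto (fun m => 2 * Real.log (n m)) atTop atTop :=
    (Real.tendsto_log_atTop.comp (tendsto_natCast_atTop_atTop.comp hn)).const_mul_atTop two_pos
  have hratio : Tendsto (fun m => 2 * Real.log (n m) / (T m / nL m)) atTop (𝓝 0) := by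
    have := h.const_mul 2
    simp only [mul_zero] at this
    exact this.congr fun m => by rw [div_div_eq_mul_div]; ring
  have hpos : ∀ᶠ m in atTop, 0 < (T m : ℝ) / nL m := by
    filter_upwards [hT.eventually_gt_atTop 0] with m hm
    have := hnL m
    positivity
  have key := (tendsto_exp_sub_mul_of_div_tendsto_zero hlog hratio hpos hκ).const_mul 4
  rw [mul_zero] at key
  refine key.congr' ?_
  filter_upwards [hn.eventually_gt_atTop 0] with m hm
  have hn' : (0 : ℝ) < n m := Nat.cast_pos.2 hm
  rw [sub_eq_add_neg, Real.exp_add, two_mul, Real.exp_add, Real.exp_log hn']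
  ring

lemma tendsto_pow_mul_pow_mul_exp_neg (hn : Tendsto n atTop atTop) (hT : Tendsto T atTop atTop)
    (hnL : ∀ m, 0 < nL m) (hd : ∀ m, 0 < d m) (hv : ∀ m, 0 < v m)
    (hT_ratio : Tendsto (fun m => (nL m : ℝ) ^ 3 * Real.log (T m) / (d m ^ 2 * v m * T m))
      atTop (𝓝 0))
    (hn_ratio : Tendsto (fun m => (nL m : ℝ) ^ 2 * Real.log (nL m) / (d m ^ 2 * v m * n m))
      atTop (𝓝 0)) {κ : ℝ} (hκ : 0 < κ) :
    Tendsto (fun m => (nL m : ℝ) ^ T m * ((T m : ℝ) + 1) ^ (nL m * n m)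
      * Real.exp (-(κ * (d m ^ 2 * (v m * n m / nL m) * (T m / nL m))))) atTop (𝓝 0) := by
  have hpos : ∀ᶠ m in atTop, 2 ≤ T m ∧ 0 < n m :=
    (hT.eventually_ge_atTop 2).and (hn.eventually_gt_atTop 0)
  have hlog : Tendsto (fun m => T m * Real.log (nL m) + 2 * (nL m * n m : ℕ) * Real.log (T m))
      atTop atTop := by
    refine tendsto_atTop_mono' _ ?_
      (Real.tendsto_log_atTop.comp (tendsto_natCast_atTop_atTop.comp hT))
    filter_upwards [hpos] with m hm
    have hone : (1 : ℝ) ≤ (nL m * n m : ℕ) := Nat.one_le_cast.2 (Nat.mul_pos (hnL m) hm.2)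
    have hlogT := Real.log_natCast_nonneg (T m)
    have hlog_nL := Real.log_natCast_nonneg (nL m)
    simp only [Function.comp_apply]
    nlinarith [mul_nonneg (Nat.cast_nonneg (α := ℝ) (T m)) hlog_nL]
  have hratio : Tendsto (fun m => (T m * Real.log (nL m) + 2 * (nL m * n m : ℕ) * Real.log (T m))
      / (d m ^ 2 * (v m * n m / nL m) * (T m / nL m))) atTop (𝓝 0) := by
    have hsum := hn_ratio.add (hT_ratio.const_mul 2)
    simp only [mul_zero, add_zero] at hsum
    refine hsum.congr' ?_
    filter_upwards [hpos] with m ⟨hTm, hnm⟩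
    have := hnL m
    have := hd m
    have := hv m
    push_cast
    field_simp
  have hgap : ∀ᶠ m in atTop, 0 < d m ^ 2 * (v m * n m / nL m) * (T m / nL m) := by
    filter_upwards [hpos] with m ⟨hTm, hnm⟩
    have := hnL m
    have := hd m
    have := hv m
    positivity
  refine squeeze_zero' (.of_forall fun m => by positivity) ?_
    (tendsto_exp_sub_mul_of_div_tendsto_zero hlog hratio hgap hκ)
  filter_upwards [hpos] with m hm
  rw [sub_eq_add_neg, Real.exp_add]
  gcongr
  exact natCast_pow_mul_add_one_pow_le_exp (hnL m) hm.1 _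

end Asymptotics

lemma HubsSeparated.sq_mul_le {nL n : ℕ} {θ : HubParams nL n} {d v : ℝ}
    (hsep : HubsSeparated θ d v) (hd : 0 < d) (hv : 0 < v) (hnL : 2 ≤ nL) : d ^ 2 * v ≤ nL := by
  obtain ⟨V, hV⟩ := hsep
  let i : Fin nL := ⟨0, by lia⟩
  let i' : Fin nL := ⟨1, by lia⟩
  have hn : (0 : ℝ) < n := Nat.cast_pos.2 (θ.pos.trans_le θ.le)
  have hnL' : (0 : ℝ) < nL := Nat.cast_pos.2 θ.pos
  have hcard : (0 : ℝ) < (V i).card := lt_of_lt_of_le (by positivity) (hV i).1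
  obtain ⟨j, hj⟩ := Finset.card_pos.1 (Nat.cast_pos.1 hcard)
  have hd1 : d ≤ 1 := by
    linarith [(hV i).2 j hj i' (by simp [i, i']), θ.A_le_one i j, θ.A_nonneg i' j]
  have hvnL : v ≤ nL := by
    have hcard_le : ((V i).card : ℝ) ≤ n :=
      Nat.cast_le.2 ((Finset.card_le_univ _).trans_eq (Fintype.card_fin n))
    have hmul := (div_le_iff₀ hnL').1 ((hV i).1.trans hcard_le)
    rw [mul_comm (n : ℝ)] at hmul
    exact le_of_mul_le_mul_right hmul hn
  exact (mul_le_of_le_one_left hv.le (pow_le_one₀ hd.le hd1)).trans hvnL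

lemma HubsSeparated.sq_mul_log_div_le {nL n : ℕ} {θ : HubParams nL n} {d v : ℝ}
    (hsep : HubsSeparated θ d v) (hd : 0 < d) (hv : 0 < v) :
    (nL : ℝ) ^ 2 * Real.log nL / (d ^ 2 * v * n)
      ≤ (nL : ℝ) ^ 4 * Real.log nL / (d ^ 4 * v ^ 2 * n) := by
  obtain hnL | hnL := (Nat.one_le_iff_ne_zero.2 θ.pos.ne').eq_or_lt
  · simp [← hnL]
  have hn : (0 : ℝ) < n := Nat.cast_pos.2 (θ.pos.trans_le θ.le)
  have hle : d ^ 2 * v ≤ (nL : ℝ) ^ 2 :=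
    (hsep.sq_mul_le hd hv hnL).trans (by exact_mod_cast Nat.le_self_pow two_ne_zero nL)
  calc (nL : ℝ) ^ 2 * Real.log nL / (d ^ 2 * v * n)
      ≤ (nL : ℝ) ^ 2 * Real.log nL / (d ^ 2 * v * n) * ((nL : ℝ) ^ 2 / (d ^ 2 * v)) :=
        le_mul_of_one_le_right
          (div_nonneg (mul_nonneg (sq_nonneg _) (Real.log_natCast_nonneg nL)) (by positivity))
          ((one_le_div (by positivity)).2 hle)
    _ = (nL : ℝ) ^ 4 * Real.log nL / (d ^ 4 * v ^ 2 * n) := by field_simp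

lemma tendsto_sq_mul_log_div_of_hubsSeparated {nL n : ℕ → ℕ} {θ : ∀ m, HubParams (nL m) (n m)}
    {d v : ℕ → ℝ} (hsep : ∀ m, HubsSeparated (θ m) (d m) (v m)) (hd : ∀ m, 0 < d m)
    (hv : ∀ m, 0 < v m)
    (h : Tendsto (fun m => (nL m : ℝ) ^ 4 * Real.log (nL m) / (d m ^ 4 * v m ^ 2 * n m))
      atTop (𝓝 0)) :
    Tendsto (fun m => (nL m : ℝ) ^ 2 * Real.log (nL m) / (d m ^ 2 * v m * n m)) atTop (𝓝 0) :=
  squeeze_zero (fun m => div_nonneg (mul_nonneg (sq_nonneg _) (Real.log_natCast_nonneg _))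
    (mul_nonneg (mul_nonneg (sq_nonneg _) (hv m).le) (Nat.cast_nonneg _)))
    (fun m => (hsep m).sq_mul_log_div_le (hd m) (hv m)) h

theorem theorem5_general (nL n T : ℕ → ℕ) (θ : ∀ m, HubParams (nL m) (n m))
    {Ω : ℕ → Type*} [∀ m, MeasurableSpace (Ω m)] (μ : ∀ m, Measure (Ω m))
    (z : ∀ m, Fin (T m) → Ω m → Fin (nL m)) (G : ∀ m, Fin (T m) → Ω m → Fin (n m) → Bool)
    (hsample : ∀ m, IsHubSample (θ m) (μ m) (z m) (G m))
    (zhat : ∀ m, Ω m → Fin (T m) → Fin (nL m))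
    (hzhat : ∀ m, ∀ᵐ ω ∂(μ m), IsProfileMLE (θ m).le (fun t => G m t ω) (zhat m ω))
    (cmin cmax : ℝ) (hcmin : 0 < cmin)
    (hρ : ∀ m i, cmin / (nL m : ℝ) ≤ (θ m).ρ i ∧ (θ m).ρ i ≤ cmax / (nL m : ℝ))
    (a c₀ : ℝ) (ha : a < 1) (hc₀ : 0 ≤ c₀)
    (hA : ∀ᶠ m in atTop, ∀ i i' : Fin (nL m), i ≠ i' →
      (θ m).A i (Fin.castLE (θ m).le i') ≤ a ∧ (θ m).A i (Fin.castLE (θ m).le i') ≤ c₀ / nL m)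
    (d v : ℕ → ℝ) (hd : ∀ m, 0 < d m) (hv : ∀ m, 0 < v m)
    (hsep : ∀ m, HubsSeparated (θ m) (d m) (v m))
    (hn : Tendsto n atTop atTop) (hT : Tendsto T atTop atTop)
    (hlog_n : Tendsto (fun m => (nL m : ℝ) * Real.log (n m) / T m) atTop (𝓝 0))
    (hlog_T : Tendsto (fun m => (nL m : ℝ) ^ 3 * Real.log (T m) / (d m ^ 2 * v m * T m))
      atTop (𝓝 0))
    (hlog_nL : Tendsto (fun m => (nL m : ℝ) ^ 2 * Real.log (nL m) / (d m ^ 2 * v m * n m))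
      atTop (𝓝 0))
    (ε : ℝ) (hε : 0 < ε) :
    Tendsto (fun m => μ m {ω | ε ≤ maxError (θ m) (fun t => G m t ω) (zhat m ω)})
      atTop (𝓝 0) := by
  have hprob (m : ℕ) : IsProbabilityMeasure (μ m) := (hsample m).indep.isProbabilityMeasure
  have hnL (m : ℕ) : 0 < nL m := (θ m).pos
  set c := cmin * Real.exp (-(c₀ / (1 - a)))
  have hc : 0 < c := by positivity
  have hbal : ∀ᶠ m in atTop, (θ m).IsBalanced c (cmax + c₀) :=
    hA.mono fun m hAm => HubParams.isBalanced ha hc₀ hAm (hρ m)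
  obtain ⟨m₀, hm₀⟩ := hbal.exists
  have hC : 0 < cmax + c₀ := hc.trans_le hm₀.le
  obtain ⟨δ, hδ, hδc, hδε⟩ : ∃ δ > 0, δ ≤ c / 2 ∧ 4 * δ / c < ε :=
    ⟨min (c / 2) (c * ε / 8), by positivity, min_le_left _ _, by
      rw [div_lt_iff₀ hc]
      nlinarith [min_le_right (c / 2) (c * ε / 8), mul_pos hc hε]⟩
  rw [← ENNReal.tendsto_toReal_zero_iff fun m => measure_ne_top _ _]
  have hbound := (tendsto_sq_mul_exp_neg hn hT hnL hlog_n (κ := δ ^ 2 / (4 * (cmax + c₀)))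
    (by positivity)).add (tendsto_pow_mul_pow_mul_exp_neg hn hT hnL hd hv hlog_T hlog_nL
      (κ := c / (6 * (cmax + c₀)) * δ / 4) (by positivity))
  rw [add_zero] at hbound
  refine squeeze_zero' (.of_forall fun m => ENNReal.toReal_nonneg) ?_ hbound
  filter_upwards [hbal] with m hm
  refine (measureReal_mono fun ω hω => hδε.trans_le hω).trans <|
    ((hsample m).measureReal_lt_maxError_le (hzhat m) hm (hsep m) (hd m) (hv m).le hδ
      hδc).trans_eq ?_
  congr 4
  ring

theorem theorem5 (nL n T : ℕ → ℕ) (θ : ∀ m, HubParams (nL m) (n m))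
    {Ω : ℕ → Type*} [∀ m, MeasurableSpace (Ω m)]
    (μ : ∀ m, Measure (Ω m)) [∀ m, IsProbabilityMeasure (μ m)]
    (z : ∀ m, Fin (T m) → Ω m → Fin (nL m))
    (G : ∀ m, Fin (T m) → Ω m → Fin (n m) → Bool)
    (hsample : ∀ m, IsHubSample (θ m) (μ m) (z m) (G m))
    -- the estimated labels, with ties broken in any way
    (zhat : ∀ m, Ω m → Fin (T m) → Fin (nL m))
    (hzhat : ∀ m, ∀ᵐ ω ∂(μ m), IsProfileMLE (θ m).le (fun t => G m t ω) (zhat m ω))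
    (cmin cmax : ℝ) (hcmin : 0 < cmin)
    (hρ : ∀ m i, cmin / (nL m : ℝ) ≤ (θ m).ρ i ∧ (θ m).ρ i ≤ cmax / (nL m : ℝ))
    (d v : ℕ → ℝ) (hd : ∀ m, 0 < d m) (hv : ∀ m, 0 < v m)
    (hsep : ∀ m, HubsSeparated (θ m) (d m) (v m))
    (hn : Tendsto n atTop atTop) (hT : Tendsto T atTop atTop) :
    -- growing number of hubs
    (Tendsto nL atTop atTop →
      (∃ c₀ : ℝ, 0 < c₀ ∧ ∀ m (i i' : Fin (nL m)), i ≠ i' →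
        (θ m).A i (Fin.castLE (θ m).le i') ≤ c₀ / (nL m : ℝ)) →
      Tendsto (fun m => (nL m : ℝ) ^ 2 * Real.log (nL m) / (T m : ℝ)) atTop (𝓝 0) →
      Tendsto (fun m => (nL m : ℝ) ^ 3 * Real.log (T m) / (d m ^ 2 * v m * (T m : ℝ)))
        atTop (𝓝 0) →
      Tendsto (fun m => (nL m : ℝ) ^ 4 * Real.log (nL m) / (d m ^ 4 * v m ^ 2 * (n m : ℝ)))
        atTop (𝓝 0) →
      Tendsto (fun m => (nL m : ℝ) * Real.log (n m) / (T m : ℝ)) atTop (𝓝 0) →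
      ∀ ε : ℝ, 0 < ε →
        Tendsto (fun m => μ m {ω | ε ≤ maxError (θ m) (fun t => G m t ω) (zhat m ω)})
          atTop (𝓝 0)) ∧
    -- fixed number of hubs
    ((∃ K : ℕ, ∀ m, nL m = K) →
      (∃ c : ℝ, c < 1 ∧ ∀ m (i i' : Fin (nL m)), i ≠ i' →
        (θ m).A i (Fin.castLE (θ m).le i') ≤ c) →
      Tendsto (fun m => Real.log (T m) / (d m ^ 2 * v m * (T m : ℝ))) atTop (𝓝 0) →
      Tendsto (fun m => d m ^ 4 * v m ^ 2 * (n m : ℝ)) atTop atTop →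
      Tendsto (fun m => Real.log (n m) / (T m : ℝ)) atTop (𝓝 0) →
      ∀ ε : ℝ, 0 < ε →
        Tendsto (fun m => μ m {ω | ε ≤ maxError (θ m) (fun t => G m t ω) (zhat m ω)})
          atTop (𝓝 0)) := by
  refine ⟨fun hnL ⟨c₀, hc₀, hA⟩ _ hlog_T hlog_nL hlog_n => ?_,
    fun ⟨K, hK⟩ ⟨c, hc, hA⟩ hlog_T hdn hlog_n => ?_⟩
  · have hhalf : ∀ᶠ m in atTop, c₀ / (nL m : ℝ) < 1 / 2 :=
      ((tendsto_natCast_atTop_atTop.comp hnL).const_div_atTop c₀).eventually_lt_const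
        one_half_pos
    exact theorem5_general nL n T θ μ z G hsample zhat hzhat cmin cmax hcmin hρ (1 / 2) c₀
      one_half_lt_one hc₀.le
      (hhalf.mono fun m hm i i' hi => ⟨(hA m i i' hi).trans hm.le, hA m i i' hi⟩) d v hd hv hsep
      hn hT hlog_n hlog_T (tendsto_sq_mul_log_div_of_hubsSeparated hsep hd hv hlog_nL)
  · obtain rfl : nL = fun _ => K := funext hK
    refine theorem5_general _ n T θ μ z G hsample zhat hzhat cmin cmax hcmin hρ c K hc
      K.cast_nonneg (.of_forall fun m i i' hi => ⟨hA m i i' hi, ?_⟩) d v hd hv hsep hn hT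
      (by simpa only [mul_div_assoc, mul_zero] using hlog_n.const_mul (K : ℝ))
      (by simpa only [mul_div_assoc, mul_zero] using hlog_T.const_mul ((K : ℝ) ^ 3))
      (tendsto_sq_mul_log_div_of_hubsSeparated hsep hd hv (hdn.const_div_atTop _))
    rw [div_self (Nat.cast_ne_zero.2 (θ m).pos.ne')]
    exact (θ m).A_le_one i _
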